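/- Let $\Sigma_{11},\Sigma_{12},\Sigma_{22},\Sigma_{33},m,g,b_3>0$ and $b_1>b_2>0$ be real with $\Sigma_{33}<\Sigma_{11}+\Sigma_{22}$ (parameters of the ellipsoidal rattleback), and let $h,\alpha\in\mathbb C$, $\alpha\neq 0$, $\alpha^2=\dfrac{2h}{m(b_1^2+b_2^2)+\Sigma_{33}}$. Put $$\sigma=\sqrt{b_1^2-b_2^2},\quad \rho_i=\frac{b_i^2}{\sigma},\quad \beta=-\frac{2mg\sigma}{m(b_1^2+b_2^2)+\Sigma_{33}},$$ $$U=\begin{pmatrix}u_{11}&u_{12}\\u_{12}&u_{22}\end{pmatrix},\quad u_{11}=\Sigma_{11}-m\rho_2^2,\quad u_{12}=\Sigma_{12}-\mathrm i m\rho_1\rho_2,\quad u_{22}=\Sigma_{22}+m\rho_1^2,\quad \theta=\det U,$$ $$\theta a_1=u_{12}(\Sigma_{11}+\Sigma_{22}-\Sigma_{33}),\quad \theta a_2=u_{22}(\Sigma_{22}-\Sigma_{33}+m\rho_2^2)+u_{12}^2,\quad \theta a_3=u_{11}(\Sigma_{33}-\Sigma_{11}+m\rho_1^2)-u_{12}^2,$$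 $$d_1=-\mathrm i mg(\rho_2-\rho_3)+\tfrac{\mathrm i}{2}m\beta\rho_3(\rho_1-2\rho_2),\quad d_2=mg(\rho_1-\rho_3)+\tfrac12 m\beta\rho_3(2\rho_1-\rho_2),$$ $$\theta c_1=u_{22}d_1-u_{12}d_2,\quad \theta c_3=u_{11}d_2-u_{12}d_1,\quad \theta c_2=-m\beta\rho_3(\Sigma_{12}\rho_1+\mathrm i\Sigma_{22}\rho_2),\quad \theta c_4=m\beta\rho_3(\Sigma_{11}\rho_1+\mathrm i\Sigma_{12}\rho_2)$$ (here $\theta\ne0$, because $\operatorname{Im}\theta=2m\Sigma_{12}\rho_1\rho_2>0$). Consider the normal variational equations of the rattleback along the solution $\omega=(0,0,p)$, $\gamma=\frac{p^2-\alpha^2}{\beta}(1,\mathrm i,0)$, in Fuchsian form: $$\frac{dx}{dp}=\Bigl(\frac{A}{p-\alpha}+\frac{A}{p+\alpha}+\frac{B}{p}\Bigr)x,\qquad (\mathrm{NVE1})$$ $$A=\begin{pmatrix}-\mathrm i a_1&-\mathrm i a_2&-\mathrm i c_2\\-\mathrm i a_3&\mathrm i a_1&-\mathrm i c_4\\-1/\beta&-\mathrm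 i/\beta&-1\end{pmatrix},\qquad B=\begin{pmatrix}-1&0&-2\mathrm i(c_1-c_2)\\0&-1&-2\mathrm i(c_3-c_4)\\0&0&0\end{pmatrix}.$$ Let $e\in\mathbb C\setminus\{0,\alpha,-\alpha\}$, and let $\Gamma_1,\Gamma_2$ be loops in $\mathbb C\setminus\{0,\alpha,-\alpha\}$ with base point $e$, going around $\alpha$ and $-\alpha$ respectively, which form a standard pair of generators of $\pi_1(\mathbb C\setminus\{\alpha,-\alpha\},e)$: there is a path $\eta$ from $e$ to $\mathrm i\alpha$ in $\mathbb C\setminus\{\alpha,-\alpha\}$ such that, in $\mathbb C\setminus\{\alpha,-\alpha\}$ with fixed end points, $\Gamma_1$ is homotopic to $\eta\,\ell_+\,\eta^{-1}$ and $\Gamma_2$ to $\eta\,\ell_-\,\eta^{-1}$, where $\ell_\pm$ is the positively oriented circle with centre $(\mathrm i\pm2)\alpha$ through $\mathrm i\alpha$ (it goes once around $\pm\alpha$ and encloses neither $\mp\alpha$ nor $0$). Let $S$ be any fundamental matrix solution of (NVE1), holomorphic near $e$. Then analytic continuation of $S$ along $\Gamma_1$ and along $\Gamma_2$ exists and gives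 $S M_+$ and $S M_-$ with unique matrices $M_+,M_-\in GL(3,\mathbb C)$, and these are permutationally conjugate: there exists $C\in GL(3,\mathbb C)$ with $$C M_+ C^{-1}=M_-,\qquad C M_- C^{-1}=M_+ .$$ -/

import Mathlib

open Complex Topology

noncomputable section

namespace Rattleback

/-! ### Parameters -/

/-- Parameters of the ellipsoidal rattleback: entries `J₁₁, J₁₂, J₂₂, J₃₃` of the inertia matrix,
semi-axes `b₁, b₂, b₃` of the ellipsoid, mass `m`, gravitational constant `g`. -/
structure Params where
  J₁₁ : ℝ
  J₁₂ : ℝ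
  J₂₂ : ℝ
  J₃₃ : ℝ
  b₁ : ℝ
  b₂ : ℝ
  b₃ : ℝ
  m : ℝ
  g : ℝ
  J₁₁_pos : 0 < J₁₁
  J₁₂_pos : 0 < J₁₂
  J₂₂_pos : 0 < J₂₂
  J₃₃_pos : 0 < J₃₃
  J₃₃_lt : J₃₃ < J₁₁ + J₂₂
  b₂_lt_b₁ : b₂ < b₁
  b₂_pos : 0 < b₂
  b₃_pos : 0 < b₃
  m_pos : 0 < m
  g_pos : 0 < g

namespace Params

variable (P : Params)

/-- `σ = √(b₁² - b₂²)`. -/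
def sigma : ℝ := Real.sqrt (P.b₁ ^ 2 - P.b₂ ^ 2)

/-- `ρᵢ = bᵢ² / σ`, equivalently `bᵢ² = ρᵢ (ρ₁ - ρ₂)`; then `ρ₁ - ρ₂ = σ`. -/
def rho₁ : ℝ := P.b₁ ^ 2 / P.sigma
def rho₂ : ℝ := P.b₂ ^ 2 / P.sigma
def rho₃ : ℝ := P.b₃ ^ 2 / P.sigma

/-- `m (b₁² + b₂²) + J₃₃`. -/
def kappa : ℝ := P.m * (P.b₁ ^ 2 + P.b₂ ^ 2) + P.J₃₃

/-- `β = -2 m g σ / (m (b₁² + b₂²) + J₃₃)`. -/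
def beta : ℝ := -(2 * P.m * P.g * P.sigma) / P.kappa

/-! ### The rattleback equations and the particular solution

`θ ω' + m r × (ω' × r) = -ω × θ ω - m r × (ω × (ω × r)) + m g r × γ - m r × (ω × r')`,
`γ' = γ × ω`, where `rᵢ = -bᵢ² γᵢ / s` and `s² = b₁² γ₁² + b₂² γ₂² + b₃² γ₃²`. -/

/-- The inertia matrix. -/
def inertia : Matrix (Fin 3) (Fin 3) ℂ :=
  !![(P.J₁₁ : ℂ), (P.J₁₂ : ℂ), 0; (P.J₁₂ : ℂ), (P.J₂₂ : ℂ), 0; 0, 0, (P.J₃₃ : ℂ)]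

/-- The squared semi-axes. -/
def axesSq : Fin 3 → ℂ := ![(P.b₁ : ℂ) ^ 2, (P.b₂ : ℂ) ^ 2, (P.b₃ : ℂ) ^ 2]

/-- The contact point `r`, as a function of `γ` and `s`. -/
def contact (γ : Fin 3 → ℂ) (s : ℂ) : Fin 3 → ℂ := fun i => -(P.axesSq i * γ i) / s

/-- The time derivative of `r`, given `γ' = dγ` and `s' = (∑ bᵢ² γᵢ γᵢ') / s`. -/
def contactVel (γ dγ : Fin 3 → ℂ) (s : ℂ) : Fin 3 → ℂ := fun i =>
  -(P.axesSq i * dγ i) / s + P.axesSq i * γ i * ((∑ k, P.axesSq k * γ k * dγ k) / s) / s ^ 2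

/-- The matrix of `u ↦ θ u + m r × (u × r)`. -/
def massMatrix (r : Fin 3 → ℂ) : Matrix (Fin 3) (Fin 3) ℂ :=
  P.inertia + (P.m : ℂ) • ((r ⬝ᵥ r) • (1 : Matrix (Fin 3) (Fin 3) ℂ) - Matrix.vecMulVec r r)

/-- The right-hand side of the equation for `ω'`. -/
def torque (ω γ : Fin 3 → ℂ) (s : ℂ) : Fin 3 → ℂ :=
  let r := P.contact γ s;
  -(crossProduct ω (P.inertia.mulVec ω))
    - (P.m : ℂ) • crossProduct r (crossProduct ω (crossProduct ω r))
    + ((P.m : ℂ) * (P.g : ℂ)) • crossProduct r γ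
    - (P.m : ℂ) • crossProduct r (crossProduct ω (P.contactVel γ (crossProduct γ ω) s))

/-- `ω'` as a function of `ω, γ, s`. -/
def accel (ω γ : Fin 3 → ℂ) (s : ℂ) : Fin 3 → ℂ :=
  (P.massMatrix (P.contact γ s))⁻¹.mulVec (P.torque ω γ s)

/-- The point of the solution curve
`ω = (0, 0, p)`, `γ = (w, i w, 0)`, `w = (p² - α²) / β`, `s = σ w`,
displaced by `v` in the directions `(ω₁, ω₂, γ₃)`: here the vector `ω`. -/
def omegaAt (p : ℂ) (v : Fin 3 → ℂ) : Fin 3 → ℂ := ![v 0, v 1, p]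

/-- The displaced point of the solution curve, the vector `γ`. -/
def gammaAt (α p : ℂ) (v : Fin 3 → ℂ) : Fin 3 → ℂ :=
  ![(p ^ 2 - α ^ 2) / P.beta, I * ((p ^ 2 - α ^ 2) / P.beta), v 2]

/-- The displaced point of the solution curve, the value of `s`: the branch of
`√(b₁² γ₁² + b₂² γ₂² + b₃² γ₃²)` that is equal to `σ w` at `v = 0`. -/
def sAt (α p : ℂ) (v : Fin 3 → ℂ) : ℂ :=
  P.sigma * ((p ^ 2 - α ^ 2) / P.beta) *
    ((∑ k, P.axesSq k * P.gammaAt α p v k ^ 2) /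
      (P.sigma * ((p ^ 2 - α ^ 2) / P.beta)) ^ 2) ^ (1 / 2 : ℂ)

/-- The components `(ω₁', ω₂', γ₃')` of the vector field at the displaced point. -/
def normalField (α p : ℂ) (v : Fin 3 → ℂ) : Fin 3 → ℂ :=
  ![P.accel (omegaAt p v) (P.gammaAt α p v) (P.sAt α p v) 0,
    P.accel (omegaAt p v) (P.gammaAt α p v) (P.sAt α p v) 1,
    crossProduct (P.gammaAt α p v) (omegaAt p v) 2]

/-! ### The normal variational equations in Fuchsian form -/

/-- The entries of the upper left block `(u₁₁, u₁₂; u₁₂, u₂₂)` of the mass matrix along the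
solution, where `r = (-ρ₁, -i ρ₂, 0)`, and its determinant `θ`. -/
def u₁₁ : ℂ := P.J₁₁ - P.m * P.rho₂ ^ 2
def u₁₂ : ℂ := P.J₁₂ - I * P.m * P.rho₁ * P.rho₂
def u₂₂ : ℂ := P.J₂₂ + P.m * P.rho₁ ^ 2
def theta : ℂ := P.u₁₁ * P.u₂₂ - P.u₁₂ ^ 2

/-- Coefficients of the normal variational equations. -/
def a₁ : ℂ := P.u₁₂ * (P.J₁₁ + P.J₂₂ - P.J₃₃) / P.theta
def a₂ : ℂ :=
  (P.u₂₂ * (P.J₂₂ - P.J₃₃ + P.m * P.rho₂ ^ 2) + P.u₁₂ ^ 2) / P.theta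
def a₃ : ℂ :=
  (P.u₁₁ * (P.J₃₃ - P.J₁₁ + P.m * P.rho₁ ^ 2) - P.u₁₂ ^ 2) / P.theta
def d₁ : ℂ :=
  -I * P.m * P.g * (P.rho₂ - P.rho₃) + I / 2 * P.m * P.beta * P.rho₃ * (P.rho₁ - 2 * P.rho₂)
def d₂ : ℂ :=
  P.m * P.g * (P.rho₁ - P.rho₃) + 1 / 2 * P.m * P.beta * P.rho₃ * (2 * P.rho₁ - P.rho₂)
def c₁ : ℂ := (P.u₂₂ * P.d₁ - P.u₁₂ * P.d₂) / P.theta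
def c₂ : ℂ :=
  -(P.m * P.beta * P.rho₃ * (P.J₁₂ * P.rho₁ + I * P.J₂₂ * P.rho₂)) / P.theta
def c₃ : ℂ := (P.u₁₁ * P.d₂ - P.u₁₂ * P.d₁) / P.theta
def c₄ : ℂ :=
  P.m * P.beta * P.rho₃ * (P.J₁₁ * P.rho₁ + I * P.J₁₂ * P.rho₂) / P.theta

/-- The residue matrix at `p = α` and at `p = -α`. -/
def A : Matrix (Fin 3) (Fin 3) ℂ :=
  !![-I * P.a₁, -I * P.a₂, -I * P.c₂;
     -I * P.a₃, I * P.a₁, -I * P.c₄;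
     -1 / (P.beta : ℂ), -I / (P.beta : ℂ), -1]

/-- The residue matrix at `p = 0`. -/
def B : Matrix (Fin 3) (Fin 3) ℂ :=
  !![-1, 0, -2 * I * (P.c₁ - P.c₂);
     0, -1, -2 * I * (P.c₃ - P.c₄);
     0, 0, 0]

/-- The coefficient matrix `T(p) = A / (p - α) + A / (p + α) + B / p` of the Fuchsian system
`dx/dp = T(p) x`. -/
def coeff (α p : ℂ) : Matrix (Fin 3) (Fin 3) ℂ :=
  (p - α)⁻¹ • P.A + (p + α)⁻¹ • P.A + p⁻¹ • P.B

variable {P}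

theorem sq_sub_pos : 0 < P.b₁ ^ 2 - P.b₂ ^ 2 := by
  nlinarith [P.b₂_lt_b₁, P.b₂_pos]

theorem sigma_pos : 0 < P.sigma := Real.sqrt_pos.2 sq_sub_pos

theorem sigma_sq : P.sigma ^ 2 = P.b₁ ^ 2 - P.b₂ ^ 2 := Real.sq_sqrt sq_sub_pos.le

theorem kappa_pos : 0 < P.kappa := by
  have h1 := P.J₃₃_pos
  have h2 := P.m_pos
  unfold kappa
  positivity

theorem beta_ne : P.beta ≠ 0 := by
  have h1 := P.m_pos
  have h2 := P.g_pos
  have h3 := P.sigma_pos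
  have h4 := P.kappa_pos
  unfold beta
  have : 0 < 2 * P.m * P.g * P.sigma / P.kappa := by positivity
  rw [neg_div]; linarith

theorem rho_sub : P.rho₁ - P.rho₂ = P.sigma := by
  have := P.sigma_pos
  rw [rho₁, rho₂, ← sub_div, ← sigma_sq]
  field_simp

theorem rho_pos : 0 < P.rho₁ ∧ 0 < P.rho₂ := by
  have h1 := P.b₂_pos
  have h2 := P.b₂_lt_b₁
  have h3 := P.sigma_pos
  have h4 : 0 < P.b₁ := h1.trans h2
  exact ⟨by unfold rho₁; positivity, by unfold rho₂; positivity⟩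

theorem theta_ne : P.theta ≠ 0 := by
  intro h
  have h1 := congrArg Complex.im h
  have h2 : P.theta.im = 2 * P.m * P.J₁₂ * P.rho₁ * P.rho₂ := by
    simp [theta, u₁₁, u₁₂, u₂₂, pow_two]
    ring
  have h3 := P.rho_pos
  have h4 := P.m_pos
  have h5 := P.J₁₂_pos
  have : 0 < 2 * P.m * P.J₁₂ * P.rho₁ * P.rho₂ := by
    obtain ⟨_, _⟩ := h3
    positivity
  rw [h2] at h1
  simp only [Complex.zero_im] at h1
  linarith

/-- Differentiation of the solution of a linear system `U F = R`. -/
theorem hasDerivAt_inv_mulVec {U : ℂ → Matrix (Fin 3) (Fin 3) ℂ} {R : ℂ → Fin 3 → ℂ}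
    {U' : Matrix (Fin 3) (Fin 3) ℂ} {R' F G : Fin 3 → ℂ}
    (hU : ∀ i j, HasDerivAt (fun ε => U ε i j) (U' i j) 0)
    (hR : ∀ i, HasDerivAt (fun ε => R ε i) (R' i) 0)
    (hdet : (U 0).det ≠ 0) (hF : (U 0).mulVec F = R 0)
    (hG : (U 0).mulVec G + U'.mulVec F = R') (i : Fin 3) :
    HasDerivAt (fun ε => ((U ε)⁻¹.mulVec (R ε)) i) (G i) 0 := by
  have hUd : ∀ i j, DifferentiableAt ℂ (fun ε => U ε i j) 0 :=
    fun i j => (hU i j).differentiableAt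
  have hRd : ∀ i, DifferentiableAt ℂ (fun ε => R ε i) 0 := fun i => (hR i).differentiableAt
  have hdetd : DifferentiableAt ℂ (fun ε => (U ε).det) 0 := by
    simp only [Matrix.det_fin_three]
    fun_prop
  have hFd : ∀ i, DifferentiableAt ℂ (fun ε => ((U ε)⁻¹.mulVec (R ε)) i) 0 := by
    intro i
    simp only [Matrix.inv_def, Ring.inverse_eq_inv', Matrix.smul_mulVec, Pi.smul_apply, smul_eq_mul]
    refine (hdetd.inv hdet).mul ?_
    simp only [Matrix.adjugate_fin_three]
    fin_cases i <;> simp [Matrix.mulVec, dotProduct, Fin.sum_univ_three] <;> fun_prop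
  have hev : ∀ᶠ ε in 𝓝 (0 : ℂ), (U ε).det ≠ 0 := hdetd.continuousAt.eventually_ne hdet
  set G' : Fin 3 → ℂ := fun i => deriv (fun ε => ((U ε)⁻¹.mulVec (R ε)) i) 0 with hG'
  have hF0 : (U 0)⁻¹.mulVec (R 0) = F := by
    rw [← hF, Matrix.mulVec_mulVec, Matrix.nonsing_inv_mul _ (isUnit_iff_ne_zero.2 hdet),
      Matrix.one_mulVec]
  have key : (U 0).mulVec G' + U'.mulVec F = R' := by
    funext k
    have e1 : HasDerivAt (fun ε => ∑ j, U ε k j * ((U ε)⁻¹.mulVec (R ε)) j)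
        (∑ j, (U' k j * ((U 0)⁻¹.mulVec (R 0)) j + U 0 k j * G' j)) 0 :=
      HasDerivAt.fun_sum fun j _ => (hU k j).mul (hFd j).hasDerivAt
    have e2 : (fun ε => ∑ j, U ε k j * ((U ε)⁻¹.mulVec (R ε)) j) =ᶠ[𝓝 0] fun ε => R ε k := by
      filter_upwards [hev] with ε hε
      have : (U ε).mulVec ((U ε)⁻¹.mulVec (R ε)) = R ε := by
        rw [Matrix.mulVec_mulVec, Matrix.mul_nonsing_inv _ (isUnit_iff_ne_zero.2 hε),
          Matrix.one_mulVec]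
      exact congrFun this k
    have e3 := (e1.congr_of_eventuallyEq e2.symm).unique (hR k)
    rw [← e3, hF0]
    simp [Matrix.mulVec, dotProduct, Finset.sum_add_distrib, add_comm]
  have : G' = G := by
    have h1 : (U 0).mulVec G' = (U 0).mulVec G := by
      have := key.trans hG.symm
      exact add_right_cancel this
    have h2 := congrArg (fun v => (U 0)⁻¹.mulVec v) h1
    simpa [Matrix.mulVec_mulVec, Matrix.nonsing_inv_mul _ (isUnit_iff_ne_zero.2 hdet)] using h2
  rw [← this]
  exact (hFd i).hasDerivAt


theorem ofReal_facts : (P.sigma : ℂ) ≠ 0 ∧ (P.beta : ℂ) ≠ 0 ∧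
    (P.rho₁ : ℂ) = P.rho₂ + P.sigma ∧
    ((P.b₁ : ℂ) ^ 2 = P.rho₁ * P.sigma ∧ (P.b₂ : ℂ) ^ 2 = P.rho₂ * P.sigma ∧
      (P.b₃ : ℂ) ^ 2 = P.rho₃ * P.sigma) ∧
    (P.beta : ℂ) * (P.m * (P.rho₁ + P.rho₂) * P.sigma + P.J₃₃) = -(2 * P.m * P.g * P.sigma) := by
  have hs := P.sigma_pos.ne'
  have hk := P.kappa_pos.ne'
  have h1 : P.b₁ ^ 2 = P.rho₁ * P.sigma := by unfold rho₁; field_simp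
  have h2 : P.b₂ ^ 2 = P.rho₂ * P.sigma := by unfold rho₂; field_simp
  have h3 : P.b₃ ^ 2 = P.rho₃ * P.sigma := by unfold rho₃; field_simp
  refine ⟨by exact_mod_cast hs, by exact_mod_cast P.beta_ne, ?_, ⟨by exact_mod_cast h1,
    by exact_mod_cast h2, by exact_mod_cast h3⟩, ?_⟩
  · have := P.rho_sub
    have : P.rho₁ = P.rho₂ + P.sigma := by linarith
    exact_mod_cast this
  · have h4 : P.m * (P.rho₁ + P.rho₂) * P.sigma + P.J₃₃ = P.kappa := by
      unfold kappa; rw [h1, h2]; ring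
    have h5 : P.beta * (P.m * (P.rho₁ + P.rho₂) * P.sigma + P.J₃₃)
        = -(2 * P.m * P.g * P.sigma) := by
      rw [h4]; unfold beta; field_simp
    exact_mod_cast h5

theorem hasDerivAt_sAt {α p : ℂ} (hp : p ^ 2 ≠ α ^ 2) (e : Fin 3 → ℂ) :
    P.sAt α p ((0 : ℂ) • e) = P.sigma * ((p ^ 2 - α ^ 2) / P.beta) ∧
    HasDerivAt (fun ε : ℂ => P.sAt α p (ε • e)) 0 0 := by
  obtain ⟨hs, hb, hr, ⟨h1, h2, h3⟩, -⟩ := P.ofReal_facts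
  have hw : (p ^ 2 - α ^ 2) / (P.beta : ℂ) ≠ 0 := div_ne_zero (sub_ne_zero.2 hp) hb
  have hsw := mul_ne_zero hs hw
  have hfun : ∀ ε : ℂ, (∑ k, P.axesSq k * P.gammaAt α p (ε • e) k ^ 2) /
      (P.sigma * ((p ^ 2 - α ^ 2) / P.beta)) ^ 2 =
      1 + (P.b₃ : ℂ) ^ 2 * e 2 ^ 2 / (P.sigma * ((p ^ 2 - α ^ 2) / P.beta)) ^ 2 * ε ^ 2 := by
    intro ε
    rw [div_eq_iff (pow_ne_zero 2 hsw), add_mul, mul_right_comm,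
      div_mul_cancel₀ _ (pow_ne_zero 2 hsw)]
    simp only [axesSq, gammaAt, Fin.sum_univ_three, Matrix.cons_val_zero, Matrix.cons_val_one,
      Matrix.cons_val, Pi.smul_apply, smul_eq_mul, mul_pow, I_sq, h1, h2, hr]
    ring
  constructor
  · unfold sAt
    rw [hfun]
    simp
  · unfold sAt
    simp only [hfun]
    have h4 : HasDerivAt (fun ε : ℂ => 1 + (P.b₃ : ℂ) ^ 2 * e 2 ^ 2 /
        (P.sigma * ((p ^ 2 - α ^ 2) / P.beta)) ^ 2 * ε ^ 2) 0 0 := by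
      refine (((hasDerivAt_id' (0 : ℂ)).pow 2).const_mul _ |>.const_add 1).congr_deriv ?_
      simp
    refine ((h4.cpow_const (c := 1 / 2) ?_).const_mul _).congr_deriv ?_
    · simp
    · simp

/-- The derivative of the vector field along the solution. -/
def dynMatrix (α p : ℂ) : Matrix (Fin 3) (Fin 3) ℂ :=
  !![P.a₁ * p, P.a₂ * p, P.c₁ + P.c₂ * (α ^ 2 / (p ^ 2 - α ^ 2));
     P.a₃ * p, -P.a₁ * p, P.c₃ + P.c₄ * (α ^ 2 / (p ^ 2 - α ^ 2));
     -I * ((p ^ 2 - α ^ 2) / P.beta), (p ^ 2 - α ^ 2) / P.beta, 0]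

theorem contact_eq (γ : Fin 3 → ℂ) (s : ℂ) : P.contact γ s =
    ![-(P.rho₁ * P.sigma * γ 0 * s⁻¹), -(P.rho₂ * P.sigma * γ 1 * s⁻¹),
      -(P.rho₃ * P.sigma * γ 2 * s⁻¹)] := by
  obtain ⟨-, -, -, ⟨h1, h2, h3⟩, -⟩ := P.ofReal_facts
  funext i
  fin_cases i <;> simp [contact, axesSq, h1, h2, h3, div_eq_mul_inv]

theorem contactVel_eq (γ dγ : Fin 3 → ℂ) (s : ℂ) : P.contactVel γ dγ s =
    let k := (P.rho₁ * P.sigma * γ 0 * dγ 0 + P.rho₂ * P.sigma * γ 1 * dγ 1 +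
      P.rho₃ * P.sigma * γ 2 * dγ 2) * s⁻¹ * s⁻¹ ^ 2
    ![-(P.rho₁ * P.sigma * dγ 0 * s⁻¹) + P.rho₁ * P.sigma * γ 0 * k,
      -(P.rho₂ * P.sigma * dγ 1 * s⁻¹) + P.rho₂ * P.sigma * γ 1 * k,
      -(P.rho₃ * P.sigma * dγ 2 * s⁻¹) + P.rho₃ * P.sigma * γ 2 * k] := by
  obtain ⟨-, -, -, ⟨h1, h2, h3⟩, -⟩ := P.ofReal_facts
  funext i
  fin_cases i <;> simp [contactVel, axesSq, h1, h2, h3, div_eq_mul_inv, Fin.sum_univ_three] <;> ring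


/-- The torque with the contact point and its velocity as independent arguments. -/
def torqueAux (ω γ r v : Fin 3 → ℂ) : Fin 3 → ℂ :=
  -(crossProduct ω (P.inertia.mulVec ω))
    - (P.m : ℂ) • crossProduct r (crossProduct ω (crossProduct ω r))
    + ((P.m : ℂ) * (P.g : ℂ)) • crossProduct r γ
    - (P.m : ℂ) • crossProduct r (crossProduct ω v)

theorem torqueAux_hasDerivAt {ω γ r v : ℂ → Fin 3 → ℂ} {p w e₀ e₁ e₂ t n : ℂ}
    (hω : ∀ ε, ω ε = ![ε * e₀, ε * e₁, p]) (hγ : ∀ ε, γ ε = ![w, I * w, ε * e₂])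
    (hr0 : r 0 = ![-(P.rho₁ : ℂ), -I * P.rho₂, 0]) (hv0 : v 0 = 0)
    (hr : ∀ k, HasDerivAt (fun ε => r ε k) (![0, 0, t] k) 0)
    (hv : ∀ k, HasDerivAt (fun ε => v ε k) (![0, 0, n] k) 0) (k : Fin 3) :
    HasDerivAt (fun ε => P.torqueAux (ω ε) (γ ε) (r ε) (v ε) k)
      (![P.u₁₂ * p * e₀ + (P.J₂₂ - P.J₃₃ + P.m * P.rho₂ ^ 2) * p * e₁
          + P.m * P.g * (-(I * P.rho₂ * e₂) - t * (I * w)) + I * P.m * P.rho₂ * p ^ 2 * t,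
        (P.J₃₃ - P.J₁₁ + P.m * P.rho₁ ^ 2) * p * e₀ - P.u₁₂ * p * e₁
          + P.m * P.g * (P.rho₁ * e₂ + t * w) - P.m * P.rho₁ * p ^ 2 * t, 0] k) 0 := by
  have hra := hr 0
  have hrb := hr 1
  have hrc := hr 2
  have hva := hv 0
  have hvb := hv 1
  have hvc := hv 2
  simp only [Matrix.cons_val_zero, Matrix.cons_val_one, Matrix.cons_val] at hra hrb hrc hva hvb hvc
  fin_cases k
  all_goals
    simp only [torqueAux, hω, hγ, inertia, crossProduct, Matrix.mulVec, dotProduct,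
      Fin.sum_univ_three, LinearMap.mk₂_apply, Pi.add_apply, Pi.sub_apply, Pi.neg_apply,
      Pi.smul_apply, smul_eq_mul,
      Matrix.of_apply, Matrix.cons_val', Matrix.cons_val_zero, Matrix.cons_val_one,
      Matrix.cons_val, Fin.zero_eta, Fin.mk_one, Fin.reduceFinMk]
    eapply HasDerivAt.congr_deriv
    on_goal 1 => (repeat' first
          | exact hasDerivAt_const _ _
          | exact hasDerivAt_id' _
          | assumption
          | apply HasDerivAt.fun_add
          | apply HasDerivAt.fun_sub
          | apply HasDerivAt.fun_neg
          | apply HasDerivAt.fun_mul)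
  all_goals
    simp [hr0, hv0, u₁₂]
  all_goals ring_nf
  all_goals simp [I_sq]


theorem contact_hasDerivAt {w : ℂ} (hw : w ≠ 0) {q : ℂ → ℂ} (hq0 : P.sigma * w * q 0 = 1)
    (hq1 : HasDerivAt q 0 0) {r : ℂ → Fin 3 → ℂ} {e₂ : ℂ}
    (hr : ∀ ε, r ε = ![-(P.rho₁ * P.sigma * w * q ε), -(P.rho₂ * P.sigma * (I * w) * q ε),
      -(P.rho₃ * P.sigma * (ε * e₂) * q ε)]) :
    r 0 = ![-(P.rho₁ : ℂ), -I * P.rho₂, 0] ∧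
    ∀ k, HasDerivAt (fun ε => r ε k) (![0, 0, -(P.rho₃ * e₂ / w)] k) 0 := by
  have hq2 : (P.sigma : ℂ) * q 0 = 1 / w := by
    rw [eq_div_iff hw]; linear_combination hq0
  constructor
  · rw [hr]
    funext k
    fin_cases k
    · simp; linear_combination (P.rho₁ : ℂ) * hq0
    · simp; linear_combination I * (P.rho₂ : ℂ) * hq0
    · simp
  · intro k
    fin_cases k
    all_goals
      simp only [hr, Matrix.cons_val_zero, Matrix.cons_val_one, Matrix.cons_val, Fin.zero_eta,
        Fin.mk_one, Fin.reduceFinMk]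
      eapply HasDerivAt.congr_deriv
      on_goal 1 => (repeat' first
          | exact hasDerivAt_const _ _
          | exact hasDerivAt_id' _
          | assumption
          | apply HasDerivAt.fun_add
          | apply HasDerivAt.fun_sub
          | apply HasDerivAt.fun_neg
          | apply HasDerivAt.fun_mul)
    · ring
    · ring
    · rw [mul_div_assoc, div_eq_mul_one_div e₂ w, ← hq2]; ring

theorem contactVel_hasDerivAt {w p : ℂ} (hw : w ≠ 0) {q : ℂ → ℂ} (hq0 : P.sigma * w * q 0 = 1)
    (hq1 : HasDerivAt q 0 0) {s : ℂ → ℂ} (hs : ∀ ε, (s ε)⁻¹ = q ε)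
    {ω γ : ℂ → Fin 3 → ℂ} {e₀ e₁ e₂ : ℂ}
    (hω : ∀ ε, ω ε = ![ε * e₀, ε * e₁, p]) (hγ : ∀ ε, γ ε = ![w, I * w, ε * e₂]) :
    P.contactVel (γ 0) (crossProduct (γ 0) (ω 0)) (s 0) = 0 ∧
    ∀ k, HasDerivAt (fun ε => P.contactVel (γ ε) (crossProduct (γ ε) (ω ε)) (s ε) k)
      (![0, 0, -(P.rho₃ * (e₁ - I * e₀)) + I * P.rho₃ * p * (e₂ / w)] k) 0 := by
  obtain ⟨hσ, -, hρ, -, -⟩ := P.ofReal_facts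
  have hq2 : q 0 = 1 / (P.sigma * w) := by
    rw [eq_div_iff (mul_ne_zero hσ hw)]; linear_combination hq0
  constructor
  · rw [contactVel_eq, hω, hγ, hs]
    funext k
    fin_cases k
    all_goals
      simp [crossProduct, hq2, hρ]
      try (first | (field_simp; done) | (field_simp; ring1) | (field_simp; ring_nf; simp [I_sq]; done))
  · intro k
    fin_cases k
    all_goals
      simp only [contactVel_eq, hω, hγ, hs, crossProduct, LinearMap.mk₂_apply,
        Matrix.cons_val_zero, Matrix.cons_val_one, Matrix.cons_val, Fin.zero_eta,
        Fin.mk_one, Fin.reduceFinMk]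
      eapply HasDerivAt.congr_deriv
      on_goal 1 => (repeat' first
          | exact hasDerivAt_const _ _
          | exact hasDerivAt_id' _
          | assumption
          | apply HasDerivAt.fun_add
          | apply HasDerivAt.fun_sub
          | apply HasDerivAt.fun_neg
          | apply HasDerivAt.fun_mul)
    all_goals
      simp [hq2, hρ]
      try (first | (field_simp; done) | (field_simp; ring1) | (field_simp; ring_nf; simp [I_sq]; done))

theorem massMatrix_hasDerivAt {r : ℂ → Fin 3 → ℂ} {t : ℂ}
    (hr0 : r 0 = ![-(P.rho₁ : ℂ), -I * P.rho₂, 0])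
    (hr : ∀ k, HasDerivAt (fun ε => r ε k) (![0, 0, t] k) 0) (i j : Fin 3) :
    HasDerivAt (fun ε => P.massMatrix (r ε) i j)
      ((((P.m : ℂ) * t) • !![0, 0, (P.rho₁ : ℂ); 0, 0, I * P.rho₂; P.rho₁, I * P.rho₂, 0]) i j) 0 := by
  have hra := hr 0
  have hrb := hr 1
  have hrc := hr 2
  simp only [Matrix.cons_val_zero, Matrix.cons_val_one, Matrix.cons_val] at hra hrb hrc
  fin_cases i <;> fin_cases j
  all_goals
    simp only [massMatrix, inertia, Matrix.vecMulVec, dotProduct, Fin.sum_univ_three,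
      Matrix.add_apply, Matrix.sub_apply, Matrix.smul_apply, smul_eq_mul, Matrix.of_apply,
      Matrix.cons_val', Matrix.cons_val_zero, Matrix.cons_val_one,
      Matrix.cons_val, Fin.zero_eta, Fin.mk_one, Fin.reduceFinMk]
    eapply HasDerivAt.congr_deriv
    on_goal 1 => (repeat' first
          | exact hasDerivAt_const _ _
          | exact hasDerivAt_id' _
          | assumption
          | apply HasDerivAt.fun_add
          | apply HasDerivAt.fun_sub
          | apply HasDerivAt.fun_neg
          | apply HasDerivAt.fun_mul)
  all_goals
    simp [hr0]
  all_goals ring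

theorem coeff_relations :
    (P.u₁₁ * P.a₁ + P.u₁₂ * P.a₃ = P.u₁₂ ∧
      P.u₁₁ * P.a₂ - P.u₁₂ * P.a₁ = P.J₂₂ - P.J₃₃ + P.m * P.rho₂ ^ 2) ∧
    (P.u₁₂ * P.a₁ + P.u₂₂ * P.a₃ = P.J₃₃ - P.J₁₁ + P.m * P.rho₁ ^ 2 ∧
      P.u₁₂ * P.a₂ - P.u₂₂ * P.a₁ = -P.u₁₂) ∧
    (P.u₁₁ * P.c₁ + P.u₁₂ * P.c₃ = P.d₁ ∧ P.u₁₂ * P.c₁ + P.u₂₂ * P.c₃ = P.d₂) ∧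
    (P.u₁₁ * P.c₂ + P.u₁₂ * P.c₄ = -I * P.m * P.beta * P.rho₃ * P.rho₂ ∧
      P.u₁₂ * P.c₂ + P.u₂₂ * P.c₄ = P.m * P.beta * P.rho₃ * P.rho₁) := by
  have hθ := P.theta_ne
  have h : P.theta * P.theta⁻¹ = 1 := mul_inv_cancel₀ hθ
  simp only [a₁, a₂, a₃, c₁, c₂, c₃, c₄, div_eq_mul_inv]
  generalize P.theta⁻¹ = t at h
  simp only [theta] at h
  refine ⟨⟨?_, ?_⟩, ⟨?_, ?_⟩, ⟨?_, ?_⟩, ⟨?_, ?_⟩⟩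
  · linear_combination (norm := (simp only [u₁₁, u₁₂, u₂₂]; ring1)) P.u₁₂ * h
  · linear_combination (norm := (simp only [u₁₁, u₁₂, u₂₂]; ring1))
      ((P.J₂₂ : ℂ) - P.J₃₃ + P.m * P.rho₂ ^ 2) * h
  · linear_combination (norm := (simp only [u₁₁, u₁₂, u₂₂]; ring1))
      ((P.J₃₃ : ℂ) - P.J₁₁ + P.m * P.rho₁ ^ 2) * h
  · linear_combination (norm := (simp only [u₁₁, u₁₂, u₂₂]; ring1)) -P.u₁₂ * h
  · linear_combination P.d₁ * h
  · linear_combination P.d₂ * h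
  · simp only [u₁₁, u₁₂, u₂₂] at h ⊢
    linear_combination (-I * P.m * P.beta * P.rho₃ * P.rho₂) * h +
      (P.m ^ 2 * P.rho₂ ^ 2 * P.beta * P.rho₃ * P.J₁₂ * P.rho₁ * t -
        P.m ^ 3 * P.rho₂ ^ 3 * P.beta * P.rho₃ * P.rho₁ ^ 2 * I * t) * I_sq
  · simp only [u₁₁, u₁₂, u₂₂] at h ⊢
    linear_combination (P.m * P.beta * P.rho₃ * P.rho₁) * h +
      (P.m ^ 2 * P.rho₁ * P.rho₂ ^ 2 * P.beta * P.rho₃ * P.J₂₂ * t +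
        P.m ^ 3 * P.rho₁ ^ 3 * P.rho₂ ^ 2 * P.beta * P.rho₃ * t) * I_sq

/-- Along the solution `ω' = (0, 0, i (p² - α²) / 2)`, that is `p' = i (p² - α²) / 2`, and the
derivative of `(ω₁', ω₂', γ₃')` in the directions `(ω₁, ω₂, γ₃)` is `dynMatrix`. -/
theorem accel_and_hasDerivAt_normalField {α p : ℂ} (hp : p ^ 2 ≠ α ^ 2) (e : Fin 3 → ℂ) :
    P.accel (omegaAt p 0) (P.gammaAt α p 0) (P.sAt α p 0) = ![0, 0, I * (p ^ 2 - α ^ 2) / 2] ∧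
    ∀ i, HasDerivAt (fun ε : ℂ => P.normalField α p (ε • e) i)
      ((P.dynMatrix α p).mulVec e i) 0 := by
  obtain ⟨hs, hb, hρ, -, hbk⟩ := P.ofReal_facts
  obtain ⟨hs0, hs1⟩ := P.hasDerivAt_sAt hp e
  have hw : (p ^ 2 - α ^ 2) / (P.beta : ℂ) ≠ 0 := div_ne_zero (sub_ne_zero.2 hp) hb
  have hsw := mul_ne_zero hs hw
  obtain ⟨q, hq⟩ : ∃ q : ℂ → ℂ, q = fun ε => (P.sAt α p (ε • e))⁻¹ := ⟨_, rfl⟩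
  have hqe : ∀ ε, (P.sAt α p (ε • e))⁻¹ = q ε := fun ε => by rw [hq]
  have hq1 : HasDerivAt q 0 0 := by
    rw [hq]
    refine (hs1.fun_inv (by rw [hs0]; exact hsw)).congr_deriv (by simp)
  have hθ := P.theta_ne
  obtain ⟨w, hwdef⟩ : ∃ w : ℂ, w = (p ^ 2 - α ^ 2) / P.beta := ⟨_, rfl⟩
  have hpw : p ^ 2 - α ^ 2 = P.beta * w := by rw [hwdef]; field_simp
  have hq0 : P.sigma * w * q 0 = 1 := by
    rw [← hqe, hs0, ← hwdef]
    exact mul_inv_cancel₀ (by rw [hwdef]; exact hsw)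
  rw [← hwdef] at hw
  have hω : ∀ ε : ℂ, omegaAt p (ε • e) = ![ε * e 0, ε * e 1, p] := fun ε => by simp [omegaAt]
  have hγ : ∀ ε : ℂ, P.gammaAt α p (ε • e) = ![w, I * w, ε * e 2] := fun ε => by
    simp [gammaAt, hwdef]
  have hr : ∀ ε : ℂ, P.contact (P.gammaAt α p (ε • e)) (P.sAt α p (ε • e)) =
      ![-(P.rho₁ * P.sigma * w * q ε), -(P.rho₂ * P.sigma * (I * w) * q ε),
      -(P.rho₃ * P.sigma * (ε * e 2) * q ε)] := fun ε => by
    rw [contact_eq, hγ, hqe]; simp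
  obtain ⟨hr0, hr1⟩ := P.contact_hasDerivAt hw hq0 hq1
    (r := fun ε => P.contact (P.gammaAt α p (ε • e)) (P.sAt α p (ε • e))) hr
  obtain ⟨hv0, hv1⟩ := P.contactVel_hasDerivAt hw hq0 hq1 hqe hω hγ
  have hU := P.massMatrix_hasDerivAt hr0 hr1
  have hR := P.torqueAux_hasDerivAt hω hγ hr0 hv0 hr1 hv1
  have hU0 : P.massMatrix (P.contact (P.gammaAt α p ((0 : ℂ) • e)) (P.sAt α p ((0 : ℂ) • e))) =
      !![P.u₁₁, P.u₁₂, 0; P.u₁₂, P.u₂₂, 0; 0, 0, P.m * (P.rho₁ + P.rho₂) * P.sigma + P.J₃₃] := by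
    rw [hr0]
    ext i j
    fin_cases i <;> fin_cases j
    all_goals
      simp [massMatrix, inertia, Matrix.vecMulVec, dotProduct, Fin.sum_univ_three, u₁₁, u₁₂, u₂₂]
      try (ring_nf; try simp [I_sq, hρ]; try ring)
  have hk : (P.m : ℂ) * (P.rho₁ + P.rho₂) * P.sigma + P.J₃₃ ≠ 0 := by
    intro h
    rw [h, mul_zero] at hbk
    have h1 : (P.m : ℂ) ≠ 0 := by exact_mod_cast P.m_pos.ne'
    have h2 : (P.g : ℂ) ≠ 0 := by exact_mod_cast P.g_pos.ne'
    have := mul_ne_zero (mul_ne_zero (mul_ne_zero two_ne_zero h1) h2) hs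
    exact this (by linear_combination hbk)
  obtain ⟨⟨E1, E2⟩, ⟨E3, E4⟩, ⟨E5, E6⟩, ⟨E7, E8⟩⟩ := P.coeff_relations
  have hf : P.beta * (α ^ 2 / (p ^ 2 - α ^ 2)) = p ^ 2 / w - P.beta := by
    have : p ^ 2 = P.beta * w + α ^ 2 := by linear_combination hpw
    rw [hpw, this]
    field_simp
    ring
  have hww : w * w⁻¹ = 1 := mul_inv_cancel₀ hw
  have hvp : (p ^ 2 - α ^ 2) * w⁻¹ = P.beta := by rw [hpw, mul_assoc, hww, mul_one]
  have hdet : (P.massMatrix (P.contact (P.gammaAt α p ((0 : ℂ) • e))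
      (P.sAt α p ((0 : ℂ) • e)))).det ≠ 0 := by
    simp only [hU0, Matrix.det_fin_three]
    have : P.theta * (P.m * (P.rho₁ + P.rho₂) * P.sigma + P.J₃₃) ≠ 0 := mul_ne_zero hθ hk
    convert this using 1
    simp [theta]
    ring
  have hF : (P.massMatrix (P.contact (P.gammaAt α p ((0 : ℂ) • e))
      (P.sAt α p ((0 : ℂ) • e)))).mulVec ![0, 0, I * (p ^ 2 - α ^ 2) / 2] =
      P.torque (omegaAt p ((0 : ℂ) • e)) (P.gammaAt α p ((0 : ℂ) • e))
        (P.sAt α p ((0 : ℂ) • e)) := by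
    change _ = P.torqueAux _ _ _ _
    simp only [hU0]
    rw [hv0, hr0, hω, hγ]
    funext k
    fin_cases k
    all_goals simp [torqueAux, inertia, crossProduct, Matrix.mulVec, dotProduct, Fin.sum_univ_three]
    rw [hpw, hρ]
    rw [hρ] at hbk
    linear_combination I * w / 2 * hbk
  have hacc : ∀ k : Fin 3, HasDerivAt
      (fun ε : ℂ => P.accel (omegaAt p (ε • e)) (P.gammaAt α p (ε • e)) (P.sAt α p (ε • e)) k)
      (![(P.dynMatrix α p).mulVec e 0, (P.dynMatrix α p).mulVec e 1, 0] k) 0 := by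
    intro k
    unfold accel
    refine hasDerivAt_inv_mulVec
      (U := fun ε => P.massMatrix (P.contact (P.gammaAt α p (ε • e)) (P.sAt α p (ε • e))))
      (R := fun ε => P.torque (omegaAt p (ε • e)) (P.gammaAt α p (ε • e)) (P.sAt α p (ε • e)))
      (F := ![0, 0, I * (p ^ 2 - α ^ 2) / 2]) hU hR hdet hF ?_ k
    · simp only [hU0]
      funext k
      fin_cases k
      all_goals simp [dynMatrix, Matrix.mulVec, dotProduct, Fin.sum_univ_three]
      · have hd : P.d₁ = -I * P.m * P.g * (P.rho₂ - P.rho₃) +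
          I / 2 * P.m * P.beta * P.rho₃ * (P.rho₁ - 2 * P.rho₂) := rfl
        linear_combination p * e 0 * E1 + p * e 1 * E2 + e 2 * E5 + e 2 * (α ^ 2 / (p ^ 2 - α ^ 2)) * E7
          - I * P.m * P.rho₃ * P.rho₂ * e 2 * hf + e 2 * hd
          - 1 / 2 * e 2 * I * P.m * P.rho₃ * P.rho₁ * hvp - e 2 * I * P.m * P.rho₃ * P.g * hww
      · have hd : P.d₂ = P.m * P.g * (P.rho₁ - P.rho₃) +
          1 / 2 * P.m * P.beta * P.rho₃ * (2 * P.rho₁ - P.rho₂) := rfl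
        linear_combination p * e 0 * E3 + p * e 1 * E4 + e 2 * E6 + e 2 * (α ^ 2 / (p ^ 2 - α ^ 2)) * E8
          + P.m * P.rho₃ * P.rho₁ * e 2 * hf + e 2 * hd
          - 1 / 2 * e 2 * P.m * P.rho₃ * P.rho₂ * I ^ 2 * hvp
          - 1 / 2 * e 2 * P.m * P.rho₃ * P.rho₂ * P.beta * I_sq + e 2 * P.m * P.rho₃ * P.g * hww
  constructor
  · rw [zero_smul] at hF hdet
    unfold accel
    rw [← hF, Matrix.mulVec_mulVec, Matrix.nonsing_inv_mul _ (isUnit_iff_ne_zero.2 hdet),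
      Matrix.one_mulVec]
  intro i
  fin_cases i
  · exact hacc 0
  · exact hacc 1
  · change HasDerivAt (fun ε : ℂ => crossProduct (P.gammaAt α p (ε • e)) (omegaAt p (ε • e)) 2) _ _
    simp only [hω, hγ, crossProduct, LinearMap.mk₂_apply, Matrix.cons_val]
    eapply HasDerivAt.congr_deriv
    on_goal 1 => (repeat' first
          | exact hasDerivAt_const _ _
          | exact hasDerivAt_id' _
          | apply HasDerivAt.fun_sub
          | apply HasDerivAt.fun_mul)
    simp [dynMatrix, Matrix.mulVec, dotProduct, Fin.sum_univ_three, ← hwdef]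
    try ring1

/-- With `dp/dt = i (p² - α²) / 2`, the normal variational equations
`dX/dp = 2 / (i (p² - α²)) • dynMatrix X` become `dx/dp = coeff α p x` under the substitution
`X = diag (p, p, p² - α²) x`. -/
theorem gauge_coeff {α p : ℂ} (hp0 : p ≠ 0) (hp : p ^ 2 ≠ α ^ 2) :
    Matrix.diagonal ![p, p, p ^ 2 - α ^ 2] * P.coeff α p + Matrix.diagonal ![1, 1, 2 * p] =
      (2 / (I * (p ^ 2 - α ^ 2))) • P.dynMatrix α p * Matrix.diagonal ![p, p, p ^ 2 - α ^ 2] := by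
  obtain ⟨-, hb, -, -, -⟩ := P.ofReal_facts
  have h1 : p - α ≠ 0 := fun h => hp (by linear_combination (p + α) * h)
  have h2 : p + α ≠ 0 := fun h => hp (by linear_combination (p - α) * h)
  have h3 : p ^ 2 - α ^ 2 = (p - α) * (p + α) := by ring
  have hI : (2 : ℂ) / (I * (p ^ 2 - α ^ 2)) = -2 * I / ((p - α) * (p + α)) := by
    rw [h3]
    field_simp
    simp
  rw [hI]
  ext i j
  fin_cases i <;> fin_cases j
  all_goals
    simp [coeff, A, B, dynMatrix, h3]
    try field_simp
    try ring_nf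
    try simp [I_sq]
    try ring_nf

end Params

/-! ### Monodromy -/

/-- `S` is, near the point `q`, a holomorphic fundamental matrix solution of `dS/dp = T(p) S`. -/
def IsFundamentalNear (T S : ℂ → Matrix (Fin 3) (Fin 3) ℂ) (q : ℂ) : Prop :=
  ∀ᶠ z in 𝓝 q, (∀ i j, HasDerivAt (fun w => S w i j) ((T z * S z) i j) z) ∧ (S z).det ≠ 0

/-- `S t`, `t ∈ [0, 1]`, is an analytic continuation along the path `γ` of a fundamental matrix
solution of `dS/dp = T(p) S`: each `S t` is a fundamental matrix solution near `γ t`, and nearby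
times give the same germs. -/
def IsContinuation (T : ℂ → Matrix (Fin 3) (Fin 3) ℂ) (γ : unitInterval → ℂ)
    (S : unitInterval → ℂ → Matrix (Fin 3) (Fin 3) ℂ) : Prop :=
  (∀ t, IsFundamentalNear T (S t) (γ t)) ∧
    ∀ t, ∀ᶠ t' in 𝓝 t, S t' =ᶠ[𝓝 (γ t')] S t

/-- `M` is the monodromy matrix, along the loop `γ`, of the fundamental matrix solution `S₀` given
near the base point: the continuation of `S₀` along `γ` is `S₀ M`. -/
def IsMonodromy (T : ℂ → Matrix (Fin 3) (Fin 3) ℂ) (γ : unitInterval → ℂ)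
    (S₀ : ℂ → Matrix (Fin 3) (Fin 3) ℂ) (M : Matrix (Fin 3) (Fin 3) ℂ) : Prop :=
  ∃ S : unitInterval → ℂ → Matrix (Fin 3) (Fin 3) ℂ, IsContinuation T γ S ∧
    S 0 =ᶠ[𝓝 (γ 0)] S₀ ∧ S 1 =ᶠ[𝓝 (γ 1)] fun z => S₀ z * M

/-- The plane without the points `α` and `-α`. -/
abbrev PuncturedPlane (α : ℂ) : Type := {p : ℂ // p ≠ α ∧ p ≠ -α}

/-- For real `k` the positively oriented circle with centre `α (i + k)` and radius `|k α|`, which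
starts at `i α`. -/
def circleFun (α k : ℂ) (t : ℝ) : ℂ := α * (I + k * (1 - exp (2 * Real.pi * t * I)))

theorem circleFun_ne {α : ℂ} (hα : α ≠ 0) {k c : ℂ} (hk : ‖k‖ = 2) (hc : ‖k + I - c‖ ^ 2 ≠ 4)
    (t : ℝ) : circleFun α k t ≠ α * c := by
  intro h
  have h1 := mul_left_cancel₀ hα h
  have h2 : k + I - c = k * exp (2 * Real.pi * t * I) := by linear_combination h1
  apply hc
  have h3 : ‖exp (2 * Real.pi * t * I)‖ = 1 := by
    have := Complex.norm_exp_ofReal_mul_I (2 * Real.pi * t)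
    simpa using this
  rw [h2, norm_mul, h3, hk]
  norm_num

theorem circleFun_mem {α : ℂ} (hα : α ≠ 0) {k : ℂ} (hk : k = 2 ∨ k = -2) (t : ℝ) :
    circleFun α k t ≠ α ∧ circleFun α k t ≠ -α := by
  have e1 : α = α * 1 := by ring
  have e2 : -α = α * (-1) := by ring
  constructor
  · conv_rhs => rw [e1]
    refine circleFun_ne hα ?_ ?_ t
    · rcases hk with rfl | rfl <;> simp
    · rcases hk with rfl | rfl <;> norm_num [Complex.sq_norm, Complex.normSq_apply]
  · rw [e2]
    refine circleFun_ne hα ?_ ?_ t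
    · rcases hk with rfl | rfl <;> simp
    · rcases hk with rfl | rfl <;> norm_num [Complex.sq_norm, Complex.normSq_apply]

/-- The point `i α`, on the line through `0` orthogonal to the direction of `α`. -/
def basePoint {α : ℂ} (hα : α ≠ 0) : PuncturedPlane α :=
  ⟨I * α, by
    have := circleFun_mem hα (Or.inl rfl) 0
    simpa [circleFun, mul_comm] using this⟩

/-- The loops `circleFun α k` in the punctured plane, `k = ±2`. -/
def circleLoop {α : ℂ} (hα : α ≠ 0) {k : ℂ} (hk : k = 2 ∨ k = -2) :
    Path (basePoint hα) (basePoint hα) where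
  toFun t := ⟨circleFun α k t, circleFun_mem hα hk t⟩
  continuous_toFun := by
    refine Continuous.subtype_mk ?_ _
    unfold circleFun
    fun_prop
  source' := by
    apply Subtype.ext
    simp [circleFun, basePoint, mul_comm]
  target' := by
    apply Subtype.ext
    simp [circleFun, basePoint, mul_comm α, Complex.exp_two_pi_mul_I]

/-- The positively oriented circle of radius `2 |α|` which touches the line `i α ℝ` at `i α` from
the side of `α`; it goes once around `α` and encloses neither `-α` nor `0`. -/
def loopPlus {α : ℂ} (hα : α ≠ 0) : Path (basePoint hα) (basePoint hα) :=
  circleLoop hα (k := 2) (Or.inl rfl)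

/-- The positively oriented circle of radius `2 |α|` which touches the line `i α ℝ` at `i α` from
the side of `-α`; it goes once around `-α` and encloses neither `α` nor `0`. -/
def loopMinus {α : ℂ} (hα : α ≠ 0) : Path (basePoint hα) (basePoint hα) :=
  circleLoop hα (k := -2) (Or.inr rfl)

/-- `Γ₁` and `Γ₂` are loops around `α` and around `-α` forming a pair of standard generators of the
fundamental group of the punctured plane: up to homotopy, and up to transport of the base point
along a common path `η`, they are the circles `loopPlus` and `loopMinus`. -/
def IsStandardPair {α : ℂ} (hα : α ≠ 0) {e : PuncturedPlane α} (Γ₁ Γ₂ : Path e e) : Prop :=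
  ∃ η : Path e (basePoint hα),
    Γ₁.Homotopic ((η.trans (loopPlus hα)).trans η.symm) ∧
    Γ₂.Homotopic ((η.trans (loopMinus hα)).trans η.symm)

end Rattleback
end

/-! The mechanism is a symmetry of the equations before they are put into Fuchsian form. With the
gauge `X = diag(p, p, p² - α²) x`, (NVE1) becomes `X' = N(p) X`, where `N = P.normalCoeff α` is `2 /
(i (p² - α²))` times `dynMatrix`. Two facts about `N` carry the theorem. It is holomorphic at `p =
0`, so that the singularity of (NVE1) there is apparent, produced by the gauge alone, and homotopies
may cross `0`. And it has a parity: its upper left block and lower right entry are odd in `p`, the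
other entries even, so that `D N(-p) = -N(p) D` for `D = diag(1, 1, -1)` (`reflection_normalCoeff`).
Hence `Y(p) ↦ D Y(-p)` maps solutions to solutions.

Write `T(γ)` for the transport of solutions of `X' = N X` along a path `γ` in `ℂ ∖ {α, -α}`, and
`ℓ_k`, `k = ±2`, for the circles based at `iα`. The reflection `p ↦ -p` takes `ℓ_{-k}` to a circle
based at `-iα` around the same point as `ℓ_k`, and sliding `ℓ_k` along the segment `δ` from `iα` to
`-iα` through `0` deforms it into that reflected circle. So `T(δ) T(ℓ_k) = T(-ℓ_{-k}) T(δ)`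
(`transport_circleLoop`), while the symmetry gives `T(-ℓ_{-k}) D = D T(ℓ_{-k})`
(`transport_map_neg`). Together, `D T(δ)` conjugates `T(ℓ_k)` into `T(ℓ_{-k})` for both signs of `k`
(`intertwine_circleLoop`): one matrix does both exchanges. Conjugating by `T(η)` and by the initial
value of the gauged fundamental matrix transfers this to the monodromy matrices at `e`.

Transport itself comes from covering theory: local solutions exist by power series, quotients of two
local fundamental solutions are locally constant, and the values of solutions therefore form a
covering space, whose monodromy is invariant under homotopy. `isMonodromy_iff` relates it to
continuation of germs of solutions of (NVE1). -/

noncomputable section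

namespace Rattleback

/-! ### Local existence of solutions by power series. -/

section LocalSolutions

variable {𝔸 : Type*} [NormedRing 𝔸] [NormedAlgebra ℂ 𝔸]

/-- The Taylor coefficients of the solution of `Y' = (∑ aₖ zᵏ) Y`, `Y(0) = 1`. -/
def odeCoeff (a : ℕ → 𝔸) : ℕ → 𝔸
  | 0 => 1
  | n + 1 => ((n : ℂ) + 1)⁻¹ • ∑ l : Fin (n + 1), a (n - l) * odeCoeff a l

theorem odeCoeff_succ (a : ℕ → 𝔸) (n : ℕ) :
    ((n : ℂ) + 1) • odeCoeff a (n + 1) =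
      ∑ kl ∈ Finset.HasAntidiagonal.antidiagonal n, a kl.1 * odeCoeff a kl.2 := by
  rw [odeCoeff, smul_inv_smul₀ (by exact_mod_cast n.succ_ne_zero),
    ← Finset.Nat.sum_antidiagonal_swap, Finset.Nat.sum_antidiagonal_eq_sum_range_succ_mk,
    Finset.sum_range]
  rfl

/-- Each of the `n + 1` terms of the recursion is at most `C ‖1‖ Kⁿ`; the factor `1 / (n + 1)`
cancels their number, and `C ≤ K` absorbs the remaining constant. The solution thus inherits the
geometric rate of the coefficients. -/
theorem norm_odeCoeff_le {a : ℕ → 𝔸} {C K : ℝ} (hC : 0 ≤ C) (hCK : C ≤ K)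
    (ha : ∀ n, ‖a n‖ ≤ C * K ^ n) (n : ℕ) : ‖odeCoeff a n‖ ≤ ‖(1 : 𝔸)‖ * K ^ n := by
  have hK : 0 ≤ K := hC.trans hCK
  induction n using Nat.strong_induction_on with
  | _ n ih =>
    rcases n with _ | n
    · simp [odeCoeff]
    · have h1 : ‖∑ l : Fin (n + 1), a (n - l) * odeCoeff a l‖ ≤
          ∑ _l : Fin (n + 1), C * ‖(1 : 𝔸)‖ * K ^ n := by
        refine norm_sum_le_of_le _ fun l _ => (norm_mul_le _ _).trans ?_
        have h2 : K ^ n = K ^ (n - (l : ℕ)) * K ^ (l : ℕ) := by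
          rw [← pow_add, Nat.sub_add_cancel (by omega)]
        calc ‖a (n - l)‖ * ‖odeCoeff a l‖
            ≤ (C * K ^ (n - (l : ℕ))) * (‖(1 : 𝔸)‖ * K ^ (l : ℕ)) :=
              mul_le_mul (ha _) (ih l l.2) (norm_nonneg _) (by positivity)
          _ = C * ‖(1 : 𝔸)‖ * K ^ n := by rw [h2]; ring
      have h3 : ‖((n : ℂ) + 1)⁻¹‖ = ((n : ℝ) + 1)⁻¹ := by
        rw [norm_inv]
        congr 1
        exact_mod_cast Complex.norm_natCast (n + 1)
      rw [odeCoeff, norm_smul, h3]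
      calc ((n : ℝ) + 1)⁻¹ * ‖∑ l : Fin (n + 1), a (n - l) * odeCoeff a l‖
          ≤ ((n : ℝ) + 1)⁻¹ * (((n : ℝ) + 1) * (C * ‖(1 : 𝔸)‖ * K ^ n)) := by
            gcongr
            simpa using h1
        _ = C * (‖(1 : 𝔸)‖ * K ^ n) := by
            rw [inv_mul_cancel_left₀ (by positivity)]; ring
        _ ≤ K * (‖(1 : 𝔸)‖ * K ^ n) := by gcongr
        _ = _ := by ring

variable [CompleteSpace 𝔸]

/-- A linear differential equation with analytic coefficients has, locally, an analytic solution
with initial value `1`. -/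
theorem exists_local_solution {N : ℂ → 𝔸} {q : ℂ} (hN : AnalyticAt ℂ N q) :
    ∃ Φ : ℂ → 𝔸, Φ q = 1 ∧ ∀ᶠ z in 𝓝 q, HasDerivAt Φ (N z * Φ z) z := by
  obtain ⟨p, hp⟩ := hN
  obtain ⟨C, ρ, hC, hρ, hb⟩ := p.le_mul_pow_of_radius_pos hp.radius_pos
  set a : ℕ → 𝔸 := p.coeff with ha
  -- Taking `K` above both `C` and `ρ` gives one geometric rate for the coefficients and for the
  -- solution. On the disc of radius `r = 1 / (2K)` both series are dominated by `2⁻ⁿ` up to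
  -- constants, and the differentiated one by `n 2⁻ⁿ`.
  set K : ℝ := max C ρ with hKdef
  have hK : 0 < K := hC.trans_le (le_max_left _ _)
  have haK : ∀ n, ‖a n‖ ≤ C * K ^ n := fun n => by
    rw [ha, ← p.norm_apply_eq_norm_coef]
    exact (hb n).trans (by gcongr; exact le_max_right _ _)
  have hbK := norm_odeCoeff_le hC.le (le_max_left C ρ) haK
  rw [← hKdef] at hbK
  set r : ℝ := (2 * K)⁻¹ with hr
  have hr0 : 0 < r := by positivity
  have hKr : K * r = 1 / 2 := by rw [hr]; field_simp
  have hball : ∀ z ∈ Metric.ball q r, ‖z - q‖ < r := fun z hz => by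
    rwa [← dist_eq_norm]
  refine ⟨fun z => ∑' n, (z - q) ^ n • odeCoeff a n, ?_, ?_⟩
  · beta_reduce
    rw [tsum_eq_single 0]
    · simp [odeCoeff]
    · intro n hn
      simp [hn]
  · filter_upwards [Metric.ball_mem_nhds q hr0, hasFPowerSeriesAt_iff'.1 hp] with z hz hNz
    have hgeo : Summable fun n : ℕ => (1 / 2 : ℝ) ^ n := summable_geometric_two
    have hsb : ∀ y ∈ Metric.ball q r, Summable fun n => ‖(y - q) ^ n • odeCoeff a n‖ := by
      intro y hy
      refine Summable.of_nonneg_of_le (fun _ => norm_nonneg _) (fun n => ?_)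
        (hgeo.mul_left ‖(1 : 𝔸)‖)
      rw [norm_smul, norm_pow]
      calc ‖y - q‖ ^ n * ‖odeCoeff a n‖ ≤ r ^ n * (‖(1 : 𝔸)‖ * K ^ n) := by
            gcongr
            · exact (hball y hy).le
            · exact hbK n
        _ = ‖(1 : 𝔸)‖ * (1 / 2) ^ n := by rw [← hKr, mul_pow]; ring
    have hsa : Summable fun n => ‖(z - q) ^ n • a n‖ := by
      refine Summable.of_nonneg_of_le (fun _ => norm_nonneg _) (fun n => ?_)
        (hgeo.mul_left C)
      rw [norm_smul, norm_pow]
      calc ‖z - q‖ ^ n * ‖a n‖ ≤ r ^ n * (C * K ^ n) := by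
            gcongr
            · exact (hball z hz).le
            · exact haK n
        _ = C * (1 / 2) ^ n := by rw [← hKr, mul_pow]; ring
    have hu : Summable fun n : ℕ => (n : ℝ) * r ^ (n - 1) * (‖(1 : 𝔸)‖ * K ^ n) := by
      have h1 := summable_pow_mul_geometric_of_norm_lt_one (R := ℝ) 1
        (r := 1 / 2) (by norm_num)
      refine (h1.mul_left (‖(1 : 𝔸)‖ * r⁻¹)).congr fun n => ?_
      rcases n with _ | n
      · simp
      · have h2 : (1 / 2 : ℝ) ^ (n + 1) = r * (r ^ n * K ^ (n + 1)) := by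
          rw [← hKr]; ring
        rw [h2]
        field_simp
        simp
    have hd := hasDerivAt_tsum_of_isPreconnected (𝕜 := ℂ) (y := z) (y₀ := q)
      (g := fun n z => (z - q) ^ n • odeCoeff a n)
      (g' := fun n z => ((n : ℂ) * (z - q) ^ (n - 1)) • odeCoeff a n) hu
      Metric.isOpen_ball (convex_ball q r).isPreconnected
      (fun n y _ => by
        have := (((hasDerivAt_id y).sub_const q).pow n).smul_const (odeCoeff a n)
        simpa using this)
      (fun n y hy => by
        rw [norm_smul, norm_mul, norm_pow, Complex.norm_natCast]
        gcongr
        · exact (hball y hy).le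
        · exact hbK n)
      (Metric.mem_ball_self hr0) (hsb q (Metric.mem_ball_self hr0)).of_norm hz
    refine hd.congr_deriv ?_
    have hs' : Summable fun n : ℕ => ((n : ℂ) * (z - q) ^ (n - 1)) • odeCoeff a n := by
      refine Summable.of_norm_bounded hu fun n => ?_
      rw [norm_smul, norm_mul, norm_pow, Complex.norm_natCast]
      gcongr
      · exact (hball z hz).le
      · exact hbK n
    -- The zeroth term of the differentiated series vanishes; after the shift of index it is
    -- compared with the Cauchy product `N z * Φ z`, where `odeCoeff_succ` matches the coefficients.
    rw [hs'.tsum_eq_zero_add, ← hNz.tsum_eq,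
      tsum_mul_tsum_eq_tsum_sum_antidiagonal_of_summable_norm hsa (hsb z hz)]
    simp only [Nat.cast_zero, zero_mul, zero_smul, zero_add]
    refine tsum_congr fun n => ?_
    have h1 : (((n + 1 : ℕ) : ℂ) * (z - q) ^ (n + 1 - 1)) • odeCoeff a (n + 1) =
        (z - q) ^ n • (((n : ℂ) + 1) • odeCoeff a (n + 1)) := by
      rw [smul_smul]
      congr 1
      push_cast
      simp [mul_comm]
    rw [h1, odeCoeff_succ, Finset.smul_sum]
    refine Finset.sum_congr rfl fun kl hkl => ?_
    rw [← Finset.HasAntidiagonal.mem_antidiagonal.1 hkl, smul_mul_smul_comm, pow_add]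

end LocalSolutions

/-! ### Solutions as a covering space, and parallel transport. -/

section Transport

variable {𝔸 : Type*} [NormedRing 𝔸] [NormedAlgebra ℂ 𝔸]

/-- `Y` is a solution of `Y' = N Y` near `q`. -/
def IsSolutionNear (N Y : ℂ → 𝔸) (q : ℂ) : Prop :=
  ∀ᶠ z in 𝓝 q, HasDerivAt Y (N z * Y z) z

theorem IsSolutionNear.mul_const {N Y : ℂ → 𝔸} {q : ℂ} (hY : IsSolutionNear N Y q) (c : 𝔸) :
    IsSolutionNear N (fun z => Y z * c) q :=
  hY.mono fun _ hz => (hz.mul_const c).congr_deriv (mul_assoc _ _ _)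

/-- An invertible solution of `Y' = N Y` on a disc, normalised at its centre. -/
structure LocalFrame (N : ℂ → 𝔸) (q : ℂ) where
  Φ : ℂ → 𝔸
  Ψ : ℂ → 𝔸
  r : ℝ
  r_pos : 0 < r
  hasDerivAt_Φ : ∀ z ∈ Metric.ball q r, HasDerivAt Φ (N z * Φ z) z
  hasDerivAt_Ψ : ∀ z ∈ Metric.ball q r, HasDerivAt Ψ (-(Ψ z * N z)) z
  mul_Ψ : ∀ z ∈ Metric.ball q r, Φ z * Ψ z = 1
  mul_Φ : ∀ z ∈ Metric.ball q r, Ψ z * Φ z = 1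
  Φ_self : Φ q = 1

/-- Units are open in a Banach algebra, so a solution with value `1` at `q` stays invertible nearby;
`(Φ⁻¹)' = -Φ⁻¹ Φ' Φ⁻¹` gives the equation for the inverse. -/
theorem nonempty_localFrame [CompleteSpace 𝔸] {N : ℂ → 𝔸} {q : ℂ} (hN : AnalyticAt ℂ N q) :
    Nonempty (LocalFrame N q) := by
  obtain ⟨Φ, h1, hΦ⟩ := exists_local_solution hN
  have hc : ContinuousAt Φ q := hΦ.self_of_nhds.continuousAt
  have hu : ∀ᶠ z in 𝓝 q, IsUnit (Φ z) :=
    hc.eventually_mem (Units.isOpen.mem_nhds (by rw [h1]; exact isUnit_one))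
  obtain ⟨r, hr, hball⟩ := Metric.eventually_nhds_iff_ball.1 (hΦ.and hu)
  refine ⟨⟨Φ, fun z => Ring.inverse (Φ z), r, hr, fun z hz => (hball z hz).1, fun z hz => ?_,
    fun z hz => Ring.mul_inverse_cancel _ (hball z hz).2,
    fun z hz => Ring.inverse_mul_cancel _ (hball z hz).2, h1⟩⟩
  obtain ⟨hd, u, hu⟩ := hball z hz
  have h2 := hasFDerivAt_ringInverse (𝕜 := ℂ) u
  rw [hu] at h2
  refine (h2.comp_hasDerivAt z hd).congr_deriv ?_
  simp [← hu, mul_assoc]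

/-- Variation of constants: `(Ψ Y)' = -Ψ N Y + Ψ N Y = 0`. This makes transition functions between
frames locally constant, which is what allows discrete fibres. -/
theorem LocalFrame.eventually_const {N : ℂ → 𝔸} {q p : ℂ} (f : LocalFrame N q)
    (hp : p ∈ Metric.ball q f.r) {Y : ℂ → 𝔸} (hY : IsSolutionNear N Y p) :
    ∀ᶠ z in 𝓝 p, f.Ψ z * Y z = f.Ψ p * Y p := by
  obtain ⟨ε, hε, hball⟩ := Metric.eventually_nhds_iff_ball.1
    (hY.and (Metric.isOpen_ball.mem_nhds hp))
  have hd : ∀ z ∈ Metric.ball p ε, HasDerivAt (fun z => f.Ψ z * Y z) 0 z := fun z hz => by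
    refine ((f.hasDerivAt_Ψ z (hball z hz).2).mul (hball z hz).1).congr_deriv ?_
    simp [mul_assoc]
  filter_upwards [Metric.ball_mem_nhds p hε] with z hz
  exact Metric.isOpen_ball.is_const_of_deriv_eq_zero (convex_ball p ε).isPreconnected
    (fun z hz => (hd z hz).differentiableAt.differentiableWithinAt)
    (fun z hz => (hd z hz).deriv) hz (Metric.mem_ball_self hε)

theorem LocalFrame.isSolutionNear {N : ℂ → 𝔸} {q p : ℂ} (f : LocalFrame N q)
    (hp : p ∈ Metric.ball q f.r) : IsSolutionNear N f.Φ p := by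
  filter_upwards [Metric.isOpen_ball.mem_nhds hp] with z hz
  exact f.hasDerivAt_Φ z hz

theorem LocalFrame.mem_self {N : ℂ → 𝔸} {q : ℂ} (f : LocalFrame N q) : q ∈ Metric.ball q f.r :=
  Metric.mem_ball_self f.r_pos

theorem LocalFrame.Ψ_self {N : ℂ → 𝔸} {q : ℂ} (f : LocalFrame N q) : f.Ψ q = 1 := by
  have := f.mul_Φ q f.mem_self
  rwa [f.Φ_self, mul_one] at this

/-- A copy of a type, with the discrete topology. -/
def DiscreteCopy (X : Type*) : Type _ := X

instance (X : Type*) : TopologicalSpace (DiscreteCopy X) := ⊥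
instance (X : Type*) : DiscreteTopology (DiscreteCopy X) := ⟨rfl⟩

theorem nhds_prod_discreteCopy {B X : Type*} [TopologicalSpace B] (p : B) (v : DiscreteCopy X) :
    𝓝 (p, v) = (𝓝 p).map fun x => (x, v) := by
  rw [nhds_prod_eq, nhds_discrete (DiscreteCopy X), Filter.prod_pure]

variable {Q : ℂ → Prop} {N : ℂ → 𝔸}

/-- The local system of solutions of `Y' = N Y`. -/
def solutionCore (f : ∀ q : Subtype Q, LocalFrame N q) :
    FiberBundleCore (Subtype Q) (Subtype Q) (DiscreteCopy 𝔸) where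
  baseSet q := Subtype.val ⁻¹' Metric.ball (q : ℂ) (f q).r
  isOpen_baseSet q := Metric.isOpen_ball.preimage continuous_subtype_val
  indexAt q := q
  mem_baseSet_at q := (f q).mem_self
  coordChange i j p := fun v : 𝔸 => (f j).Ψ p * (f i).Φ p * v
  coordChange_self i p hp := fun v : 𝔸 => by
    change ((f i).Ψ p * (f i).Φ p * v : 𝔸) = v
    rw [(f i).mul_Φ _ hp, one_mul]
  continuousOn_coordChange i j := by
    rintro ⟨p, (v : 𝔸)⟩ ⟨⟨hi, hj⟩, -⟩
    apply ContinuousAt.continuousWithinAt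
    -- Near `(p, v)` the discrete coordinate stays equal to `v` and the factor `Ψ_j Φ_i` is
    -- constant, so the whole map is locally constant.
    refine (continuousAt_const (y := (show DiscreteCopy 𝔸 from (f j).Ψ p * (f i).Φ p * v))).congr ?_
    have h1 := continuous_subtype_val.continuousAt.eventually
      ((f j).eventually_const hj ((f i).isSolutionNear hi))
    refine Filter.Eventually.filter_mono (nhds_prod_discreteCopy p v).le (Filter.eventually_map.2 ?_)
    filter_upwards [h1] with p' hp'
    change ((f j).Ψ p * (f i).Φ p * v : 𝔸) = (f j).Ψ p' * (f i).Φ p' * v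
    rw [hp']
  coordChange_comp i j k p hp := fun v : 𝔸 => by
    change ((f k).Ψ p * (f j).Φ p * ((f j).Ψ p * (f i).Φ p * v) : 𝔸) = (f k).Ψ p * (f i).Φ p * v
    have := (f j).mul_Ψ _ hp.1.2
    simp only [mul_assoc]
    rw [← mul_assoc ((f j).Φ p), this, one_mul]

theorem isCoveringMap_proj (f : ∀ q : Subtype Q, LocalFrame N q) :
    IsCoveringMap (solutionCore f).proj :=
  FiberBundle.isCoveringMap (F := DiscreteCopy 𝔸) (E := (solutionCore f).Fiber)

/-- `V` consists of the values of a continuation of a solution of `Y' = N Y` along `γ`. -/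
def IsFlat (N : ℂ → 𝔸) {T : Type*} [TopologicalSpace T] (γ : T → ℂ) (V : T → 𝔸) : Prop :=
  ∀ t, ∃ Y, IsSolutionNear N Y (γ t) ∧ ∀ᶠ t' in 𝓝 t, V t' = Y (γ t')

theorem IsFlat.mul_const {T : Type*} [TopologicalSpace T] {γ : T → ℂ} {V : T → 𝔸}
    (hV : IsFlat N γ V) (c : 𝔸) : IsFlat N γ fun t => V t * c := fun t => by
  obtain ⟨Y, hY, h⟩ := hV t
  exact ⟨_, hY.mul_const c, h.mono fun t' h' => congrArg (· * c) h'⟩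

/-- In the chart centred at `γ t` the lift has coordinate `Ψ V`; since the fibre is discrete,
continuity says that this is locally constant, that is, `V = Φ · const` locally, which is a
solution. -/
theorem continuous_iff_isFlat (f : ∀ q : Subtype Q, LocalFrame N q) {T : Type*}
    [TopologicalSpace T] {γ : T → Subtype Q} (hγ : Continuous γ) {V : T → 𝔸} :
    Continuous (fun t => (⟨γ t, V t⟩ : (solutionCore f).TotalSpace)) ↔
      IsFlat N (fun t => (γ t : ℂ)) V := by
  rw [continuous_iff_continuousAt]
  refine forall_congr' fun t => ?_
  -- The value over each point is recorded in the frame centred at that point, where `Φ = 1`, so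
  -- only the factor `Ψ` of the fixed chart remains.
  have h1 : ∀ t', (trivializationAt (DiscreteCopy 𝔸) (solutionCore f).Fiber (γ t)
      (⟨γ t', V t'⟩ : (solutionCore f).TotalSpace)).2 = (f (γ t)).Ψ (γ t') * V t' := fun t' => by
    change ((f (γ t)).Ψ (γ t') * (f (γ t')).Φ (γ t') * V t' : 𝔸) = _
    rw [(f (γ t')).Φ_self, mul_one]
  have hγt : Filter.Tendsto (fun t' => (γ t' : ℂ)) (𝓝 t) (𝓝 (γ t : ℂ)) :=
    (continuous_subtype_val.comp hγ).continuousAt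
  have h2 : ContinuousAt (fun t => (⟨γ t, V t⟩ : (solutionCore f).TotalSpace)) t ↔
      ∀ᶠ t' in 𝓝 t, (f (γ t)).Ψ (γ t') * V t' = V t := by
    refine (FiberBundle.continuousAt_totalSpace (DiscreteCopy 𝔸) _).trans
      ((and_iff_right hγ.continuousAt).trans ?_)
    change Filter.Tendsto (fun t' => (trivializationAt (DiscreteCopy 𝔸) (solutionCore f).Fiber
      (γ t) (⟨γ t', V t'⟩ : (solutionCore f).TotalSpace)).2) (𝓝 t) (𝓝 _) ↔ _
    rw [nhds_discrete (DiscreteCopy 𝔸)]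
    refine Filter.tendsto_pure.trans (Filter.eventually_congr (.of_forall fun t' => ?_))
    exact Eq.congr (h1 t') ((h1 t).trans (by rw [(f (γ t)).Ψ_self, one_mul]))
  rw [h2]
  constructor
  · intro h
    refine ⟨_, ((f (γ t)).isSolutionNear (f (γ t)).mem_self).mul_const (V t), ?_⟩
    filter_upwards [h, hγt.eventually (Metric.isOpen_ball.mem_nhds (f (γ t)).mem_self)]
      with t' ht' hb
    rw [← ht', ← mul_assoc, (f (γ t)).mul_Ψ _ hb, one_mul]
  · rintro ⟨Y, hY, h⟩
    have h3 := h.self_of_nhds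
    filter_upwards [h, hγt.eventually ((f (γ t)).eventually_const (f (γ t)).mem_self hY)]
      with t' ht' hb
    rw [ht', hb, (f (γ t)).Ψ_self, one_mul, h3]

/-- The point of the fibre over `a` given by the value `v`. -/
def fiberPoint (f : ∀ q : Subtype Q, LocalFrame N q) (a : Subtype Q) (v : 𝔸) :
    (solutionCore f).proj ⁻¹' {a} :=
  ⟨⟨a, v⟩, rfl⟩

theorem fiberPoint_injective (f : ∀ q : Subtype Q, LocalFrame N q) (a : Subtype Q) :
    Function.Injective (fiberPoint f a) := fun v w h => by
  have := congrArg Subtype.val h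
  exact eq_of_heq (Bundle.TotalSpace.mk.inj this).2

theorem monodromy_fiberPoint (f : ∀ q : Subtype Q, LocalFrame N q) {a b : Subtype Q}
    (γ : Path a b) {V : unitInterval → 𝔸} (hV : IsFlat N (fun t => (γ t : ℂ)) V) :
    (isCoveringMap_proj f).monodromy (.mk γ) (fiberPoint f a (V 0)) = fiberPoint f b (V 1) := by
  have hc := (continuous_iff_isFlat f γ.continuous).2 hV
  apply Subtype.ext
  have h0 : (γ : C(unitInterval, Subtype Q)) 0 =
      (solutionCore f).proj (fiberPoint f a (V 0)).1 := γ.source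
  have := ((isCoveringMap_proj f).eq_liftPath_iff' (γ := γ) (γ_0 := h0)
    (Γ := ⟨_, hc⟩)).2 ⟨rfl, ?_⟩
  · have h1 := DFunLike.congr_fun this 1
    refine h1.symm.trans ?_
    change (⟨γ 1, V 1⟩ : (solutionCore f).TotalSpace) = ⟨b, V 1⟩
    rw [γ.target]
  · change (⟨γ 0, V 0⟩ : (solutionCore f).TotalSpace) = ⟨a, V 0⟩
    rw [γ.source]

theorem exists_isFlat (f : ∀ q : Subtype Q, LocalFrame N q) {a b : Subtype Q} (γ : Path a b)
    (v : 𝔸) : ∃ V : unitInterval → 𝔸, IsFlat N (fun t => (γ t : ℂ)) V ∧ V 0 = v := by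
  obtain ⟨Γ, h1, h2⟩ := (isCoveringMap_proj f).exists_path_lifts (γ : C(unitInterval, Subtype Q))
    (fiberPoint f a v).1 γ.source
  have h3 : ∀ t, Γ t = (⟨γ t, ((Γ t).2 : 𝔸)⟩ : (solutionCore f).TotalSpace) := fun t => by
    rw [← show (Γ t).1 = γ t from congrFun h1 t]
  refine ⟨fun t => (Γ t).2, (continuous_iff_isFlat f γ.continuous).1 ?_, ?_⟩
  · exact Γ.continuous.congr h3
  · beta_reduce
    rw [h2]
    rfl

/-- The value at the end of `γ` of the continuation along `γ` of the solution with the value `1`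
at the start of `γ`. -/
def transport (f : ∀ q : Subtype Q, LocalFrame N q) {a b : Subtype Q} (γ : Path a b) : 𝔸 :=
  (exists_isFlat f γ 1).choose 1

/-- Right multiplication by a constant preserves the equation, so the normalised continuation times
`V 0` is flat with the same initial value as `V`; both lifts then end at the same point of the
covering. -/
theorem IsFlat.eq_transport (f : ∀ q : Subtype Q, LocalFrame N q) {a b : Subtype Q}
    {γ : Path a b} {V : unitInterval → 𝔸} (hV : IsFlat N (fun t => (γ t : ℂ)) V) :
    V 1 = transport f γ * V 0 := by
  obtain ⟨h1, h2⟩ := (exists_isFlat f γ 1).choose_spec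
  have h3 := monodromy_fiberPoint f γ hV
  have h4 := monodromy_fiberPoint f γ (h1.mul_const (V 0))
  rw [h2, one_mul, h3] at h4
  exact fiberPoint_injective f b h4

theorem monodromy_eq_transport (f : ∀ q : Subtype Q, LocalFrame N q) {a b : Subtype Q}
    (γ : Path a b) (v : 𝔸) : (isCoveringMap_proj f).monodromy (.mk γ) (fiberPoint f a v) =
      fiberPoint f b (transport f γ * v) := by
  obtain ⟨V, hV, rfl⟩ := exists_isFlat f γ v
  rw [monodromy_fiberPoint f γ hV, hV.eq_transport f]

theorem transport_eq_of_homotopic (f : ∀ q : Subtype Q, LocalFrame N q) {a b : Subtype Q}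
    {γ γ' : Path a b} (h : γ.Homotopic γ') : transport f γ = transport f γ' := by
  have h1 := monodromy_eq_transport f γ 1
  rw [Path.Homotopic.Quotient.eq.2 h, monodromy_eq_transport, mul_one, mul_one] at h1
  exact (fiberPoint_injective f b h1).symm

/-- The order is reversed because transport acts on values by left multiplication. -/
theorem transport_trans (f : ∀ q : Subtype Q, LocalFrame N q) {a b c : Subtype Q}
    (γ : Path a b) (γ' : Path b c) :
    transport f (γ.trans γ') = transport f γ' * transport f γ := by
  have h1 := monodromy_eq_transport f (γ.trans γ') 1
  rw [Path.Homotopic.Quotient.mk_trans, IsCoveringMap.monodromy_trans_apply,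
    monodromy_eq_transport, monodromy_eq_transport, mul_one, mul_one] at h1
  exact (fiberPoint_injective f c h1).symm

theorem transport_refl (f : ∀ q : Subtype Q, LocalFrame N q) (a : Subtype Q) :
    transport f (Path.refl a) = 1 := by
  have h1 := monodromy_eq_transport f (Path.refl a) 1
  rw [Path.Homotopic.Quotient.mk_refl, IsCoveringMap.monodromy_refl, id, mul_one] at h1
  exact (fiberPoint_injective f a h1).symm

theorem transport_symm_mul (f : ∀ q : Subtype Q, LocalFrame N q) {a b : Subtype Q}
    (γ : Path a b) : transport f γ.symm * transport f γ = 1 := by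
  rw [← transport_trans, ← transport_refl f a]
  exact transport_eq_of_homotopic f ⟨(Path.Homotopy.reflTransSymm γ).symm⟩

theorem transport_mul_symm (f : ∀ q : Subtype Q, LocalFrame N q) {a b : Subtype Q}
    (γ : Path a b) : transport f γ * transport f γ.symm = 1 := by
  have := transport_symm_mul f γ.symm
  rwa [Path.symm_symm] at this

/-- The transport along a path, as an invertible element. -/
def transportUnit (f : ∀ q : Subtype Q, LocalFrame N q) {a b : Subtype Q} (γ : Path a b) : 𝔸ˣ :=
  ⟨transport f γ, transport f γ.symm, transport_mul_symm f γ, transport_symm_mul f γ⟩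

end Transport

/-! ### Continuation over simply connected domains, and the symmetry of solutions. -/

section Continuation

variable {𝔸 : Type*} [NormedRing 𝔸] [NormedAlgebra ℂ 𝔸] {Q : ℂ → Prop} {N : ℂ → 𝔸}

theorem IsFlat.comp {T T' : Type*} [TopologicalSpace T] [TopologicalSpace T'] {γ : T → ℂ}
    {V : T → 𝔸} (hV : IsFlat N γ V) {τ : T' → T} (hτ : Continuous τ) :
    IsFlat N (γ ∘ τ) (V ∘ τ) := fun t => by
  obtain ⟨Y, hY, h⟩ := hV (τ t)
  exact ⟨Y, hY, hτ.continuousAt.eventually h⟩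

/-- Lifting to the covering over a two-dimensional parameter domain lets transports along the sides
of a rectangle be compared directly. -/
theorem exists_isFlat_of_simplyConnected (f : ∀ q : Subtype Q, LocalFrame N q) {T : Type*}
    [TopologicalSpace T] [SimplyConnectedSpace T] [LocallyPathConnectedSpace T]
    (γ : C(T, Subtype Q)) (t₀ : T) (v : 𝔸) :
    ∃ V : T → 𝔸, IsFlat N (fun t => (γ t : ℂ)) V ∧ V t₀ = v := by
  obtain ⟨Γ, ⟨h2, h1⟩, -⟩ := (isCoveringMap_proj f).existsUnique_continuousMap_lifts γ t₀
    (fiberPoint f (γ t₀) v).1 rfl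
  have h3 : ∀ t, Γ t = (⟨γ t, ((Γ t).2 : 𝔸)⟩ : (solutionCore f).TotalSpace) := fun t => by
    rw [← show (Γ t).1 = γ t from congrFun h1 t]
  refine ⟨fun t => (Γ t).2, (continuous_iff_isFlat f γ.continuous).1 ?_, ?_⟩
  · exact Γ.continuous.congr h3
  · beta_reduce
    rw [h2]
    rfl

theorem IsFlat.isUnit (f : ∀ q : Subtype Q, LocalFrame N q) {a b : Subtype Q} {γ : Path a b}
    {V : unitInterval → 𝔸} (hV : IsFlat N (fun t => (γ t : ℂ)) V) (h0 : IsUnit (V 0))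
    (t : unitInterval) : IsUnit (V t) := by
  have hτ : Continuous fun s : unitInterval => s * t := by fun_prop
  -- The initial piece of `γ` up to time `t`, reparametrised to the unit interval; transport along
  -- it is invertible.
  let δ : Path (γ 0) (γ t) := ⟨⟨fun s => γ (s * t), γ.continuous.comp hτ⟩, by simp, by simp⟩
  have h1 : IsFlat N (fun s => (δ s : ℂ)) (V ∘ fun s => s * t) := hV.comp hτ
  have h2 := h1.eq_transport f
  simp only [Function.comp_apply, one_mul, zero_mul] at h2
  rw [h2]
  exact (transportUnit f δ).isUnit.mul h0

theorem IsSolutionNear.eventuallyEq {q : ℂ} (f : LocalFrame N q) {Y Z : ℂ → 𝔸}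
    (hY : IsSolutionNear N Y q) (hZ : IsSolutionNear N Z q) (h : Y q = Z q) : Y =ᶠ[𝓝 q] Z := by
  filter_upwards [f.eventually_const f.mem_self hY, f.eventually_const f.mem_self hZ,
    Metric.isOpen_ball.mem_nhds f.mem_self] with z h1 h2 h3
  rw [← one_mul (Y z), ← one_mul (Z z), ← f.mul_Ψ z h3, mul_assoc, mul_assoc, h1, h2, h]

/-- A symmetry `z ↦ -z` of the differential equation acts on its continued solutions. -/
theorem IsFlat.neg {D : 𝔸} (hD : ∀ z, D * N (-z) = -(N z * D)) {T : Type*} [TopologicalSpace T]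
    {γ : T → ℂ} {V : T → 𝔸} (hV : IsFlat N γ V) :
    IsFlat N (fun t => -γ t) fun t => D * V t := fun t => by
  obtain ⟨Y, hY, h⟩ := hV t
  refine ⟨fun z => D * Y (-z), ?_, h.mono fun t' h' => ?_⟩
  · have h1 : Filter.Tendsto (fun z : ℂ => -z) (𝓝 (-γ t)) (𝓝 (γ t)) := by
      have := (continuous_neg (G := ℂ)).tendsto (-γ t)
      rwa [neg_neg] at this
    refine (h1.eventually hY).mono fun z hz => ?_
    have h2 : HasDerivAt (fun z => Y (-z)) (-(N (-z) * Y (-z))) z := by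
      have := hz.scomp z (hasDerivAt_neg z)
      rw [neg_one_smul] at this
      exact this
    refine (h2.const_mul D).congr_deriv ?_
    rw [mul_neg, ← mul_assoc, hD, neg_mul, neg_neg, mul_assoc]
  · change D * V t' = D * Y (- -γ t')
    rw [neg_neg, h']

end Continuation

/-! ### Sliding and reflecting the two circles. -/

section Circles

variable {𝔸 : Type*} [NormedRing 𝔸] [NormedAlgebra ℂ 𝔸] {α : ℂ} {N : ℂ → 𝔸}

/-- The homotopy moving the circles `circleFun α k` along the diameter from `i α` to `-i α`. -/
def circleHomotopy (α k : ℂ) (x : ℝ × ℝ) : ℂ :=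
  α * (Real.cos x.1 * I + k * (1 - exp (x.2 * I)))

/-- With `u = cos x.1`, the circle has centre `α (k + i u)` and radius `2 |α|`. The squared distance
from its centre to `±α`, in units of `|α|²`, is `1 + u²` or `9 + u²`, and never equals `4` since `u²
≤ 1`. The circle may pass through `0`. -/
theorem circleHomotopy_mem (hα : α ≠ 0) {k : ℂ} (hk : k = 2 ∨ k = -2) (x : ℝ × ℝ) :
    circleHomotopy α k x ≠ α ∧ circleHomotopy α k x ≠ -α := by
  have key : ∀ c : ℂ, (c = 1 ∨ c = -1) → circleHomotopy α k x ≠ α * c := by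
    intro c hc h
    have h1 := mul_left_cancel₀ hα h
    have h2 : k + Real.cos x.1 * I - c = k * exp (x.2 * I) := by linear_combination h1
    have h3 : Complex.normSq (k + Real.cos x.1 * I - c) = 4 := by
      rw [h2, map_mul, Complex.normSq_eq_norm_sq (exp _), Complex.norm_exp_ofReal_mul_I]
      rcases hk with rfl | rfl <;> norm_num [Complex.normSq_apply]
    have h4 : Real.cos x.1 ^ 2 ≤ 1 := Real.cos_sq_le_one _
    rcases hk with rfl | rfl <;> rcases hc with rfl | rfl <;>
      simp [Complex.normSq_apply, -Complex.ofReal_cos] at h3 <;> nlinarith [sq_nonneg (Real.cos x.1)]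
  exact ⟨by simpa using key 1 (Or.inl rfl), by simpa using key (-1) (Or.inr rfl)⟩

/-- Reflection of the punctured plane. -/
def negPlane (p : PuncturedPlane α) : PuncturedPlane α :=
  ⟨-p, fun h => p.2.2 (neg_eq_iff_eq_neg.1 h), fun h => p.2.1 (neg_injective h)⟩

theorem continuous_negPlane : Continuous (negPlane (α := α)) :=
  (continuous_subtype_val.neg).subtype_mk _

/-- The homotopy of circles as a map to the punctured plane. -/
def circleHomotopyMap (hα : α ≠ 0) {k : ℂ} (hk : k = 2 ∨ k = -2) :
    C(ℝ × ℝ, PuncturedPlane α) where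
  toFun x := ⟨circleHomotopy α k x, circleHomotopy_mem hα hk x⟩
  continuous_toFun := by
    refine Continuous.subtype_mk ?_ _
    unfold circleHomotopy
    fun_prop

/-- A path from `i α` to `-i α`. -/
def diameterPath (hα : α ≠ 0) : Path (basePoint hα) (negPlane (basePoint hα)) where
  toFun t := ⟨circleHomotopy α 2 (Real.pi * t, 0), circleHomotopy_mem hα (Or.inl rfl) _⟩
  continuous_toFun := by
    refine Continuous.subtype_mk ?_ _
    unfold circleHomotopy
    fun_prop
  source' := by
    apply Subtype.ext
    simp [circleHomotopy, basePoint, mul_comm]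
  target' := by
    apply Subtype.ext
    simp [circleHomotopy, basePoint, negPlane, mul_comm]

theorem neg_hk {k : ℂ} (hk : k = 2 ∨ k = -2) : -k = 2 ∨ -k = -2 := by
  rcases hk with rfl | rfl <;> simp

/-- Transport along the circle on one side is conjugate to transport along the reflection of the
circle on the other side. -/
theorem transport_circleLoop (f : ∀ q : PuncturedPlane α, LocalFrame N q) (hα : α ≠ 0) {k : ℂ}
    (hk : k = 2 ∨ k = -2) :
    transport f (diameterPath hα) * transport f (circleLoop hα hk) =
      transport f ((circleLoop hα (neg_hk hk)).map continuous_negPlane) *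
        transport f (diameterPath hα) := by
  -- A solution continued over the whole parameter plane is evaluated at the corners of `[0, π] ×
  -- [0, 2π]`; the two ways from `(0, 0)` to `(π, 2π)` give the two sides of the identity.
  obtain ⟨V, hV, hV0⟩ := exists_isFlat_of_simplyConnected f (circleHomotopyMap hα hk) (0, 0) 1
  have side : ∀ {a b : PuncturedPlane α} (γ : Path a b) (τ : unitInterval → ℝ × ℝ),
      Continuous τ → (∀ t, (γ t : ℂ) = circleHomotopy α k (τ t)) →
        V (τ 1) = transport f γ * V (τ 0) := by
    intro a b γ τ hτ h
    refine IsFlat.eq_transport f (γ := γ) (V := V ∘ τ) ?_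
    have h1 := hV.comp hτ
    have h2 : (fun t => (γ t : ℂ)) = (fun x => (circleHomotopyMap hα hk x : ℂ)) ∘ τ := funext h
    rwa [h2]
  have e1 := side (diameterPath hα) (fun t => (Real.pi * t, 0)) (by fun_prop) fun t => by
    simp [diameterPath, circleHomotopy]
  -- Opposite sides lie over the same path from `iα` to `-iα`, because `exp (2πi) = 1`.
  have e2 := side (diameterPath hα) (fun t => (Real.pi * t, 2 * Real.pi)) (by fun_prop)
    fun t => by simp [diameterPath, circleHomotopy, Complex.exp_two_pi_mul_I]
  have e3 := side (circleLoop hα hk) (fun t => (0, 2 * Real.pi * t)) (by fun_prop) fun t => by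
    simp [circleLoop, circleFun, circleHomotopy]
  -- At `x.1 = π` the circle is `α (-i + k (1 - exp))`, the negative of `circleFun α (-k)`.
  have e4 := side ((circleLoop hα (neg_hk hk)).map continuous_negPlane)
    (fun t => (Real.pi, 2 * Real.pi * t)) (by fun_prop) fun t => by
    change -circleFun α (-k) t = _
    simp [circleFun, circleHomotopy]
    ring
  simp only [Set.Icc.coe_one, Set.Icc.coe_zero, mul_one, mul_zero, hV0] at e1 e2 e3 e4
  rw [e3, e4, e1] at e2
  exact e2.symm

/-- If `V` is flat along `γ` with `V 0 = 1`, then `D V` is flat along `-γ` and starts at `D`;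
comparing the values at the end gives the identity. -/
theorem transport_map_neg (f : ∀ q : PuncturedPlane α, LocalFrame N q) {D : 𝔸}
    (hD : ∀ z, D * N (-z) = -(N z * D)) {a b : PuncturedPlane α} (γ : Path a b) :
    transport f (γ.map continuous_negPlane) * D = D * transport f γ := by
  obtain ⟨V, hV, hV0⟩ := exists_isFlat f γ 1
  have h1 := hV.eq_transport f
  have h2 : IsFlat N (fun t => ((γ.map continuous_negPlane) t : ℂ)) fun t => D * V t := hV.neg hD
  have h3 := h2.eq_transport f
  rw [hV0, mul_one] at h1 h3
  rw [← h3, h1]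

/-- If `D` intertwines the differential equation with its reflection, then the transports along
the two circles are conjugate to each other by one and the same element. -/
theorem intertwine_circleLoop (f : ∀ q : PuncturedPlane α, LocalFrame N q) {D : 𝔸}
    (hD : ∀ z, D * N (-z) = -(N z * D)) (hD2 : D * D = 1) (hα : α ≠ 0) {k : ℂ}
    (hk : k = 2 ∨ k = -2) :
    D * transport f (diameterPath hα) * transport f (circleLoop hα hk) =
      transport f (circleLoop hα (neg_hk hk)) * (D * transport f (diameterPath hα)) := by
  have h1 := transport_circleLoop f hα hk
  have h2 := transport_map_neg f hD (circleLoop hα (neg_hk hk))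
  calc D * transport f (diameterPath hα) * transport f (circleLoop hα hk)
      = D * (transport f ((circleLoop hα (neg_hk hk)).map continuous_negPlane) * (D * D)) *
          transport f (diameterPath hα) := by rw [mul_assoc, h1, hD2]; noncomm_ring
    _ = D * (transport f ((circleLoop hα (neg_hk hk)).map continuous_negPlane) * D) * D *
          transport f (diameterPath hα) := by noncomm_ring
    _ = (D * D) * transport f (circleLoop hα (neg_hk hk)) * D *
          transport f (diameterPath hα) := by rw [h2]; noncomm_ring
    _ = _ := by rw [hD2]; noncomm_ring

end Circles

/-! ### The gauge transformation and the monodromy matrices of (NVE1). -/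

section Matrices

attribute [local instance] Matrix.linftyOpNormedRing Matrix.linftyOpNormedAlgebra

theorem hasDerivAt_matrix_iff {F : ℂ → Matrix (Fin 3) (Fin 3) ℂ} {F' : Matrix (Fin 3) (Fin 3) ℂ}
    {z : ℂ} : HasDerivAt F F' z ↔ ∀ i j, HasDerivAt (fun w => F w i j) (F' i j) z := by
  constructor
  · intro h i j
    let L : Matrix (Fin 3) (Fin 3) ℂ →ₗ[ℂ] ℂ := Matrix.entryLinearMap ℂ ℂ i j
    exact (LinearMap.toContinuousLinearMap L).hasFDerivAt.comp_hasDerivAt z h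
  · intro h
    have h1 : HasDerivAt (fun w => ∑ i, ∑ j, F w i j • Matrix.single i j (1 : ℂ))
        (∑ i, ∑ j, F' i j • Matrix.single i j (1 : ℂ)) z :=
      HasDerivAt.fun_sum fun i _ => HasDerivAt.fun_sum fun j _ => (h i j).smul_const _
    have h2 : ∀ M : Matrix (Fin 3) (Fin 3) ℂ, ∑ i, ∑ j, M i j • Matrix.single i j (1 : ℂ) = M := by
      intro M
      conv_rhs => rw [Matrix.matrix_eq_sum_single M]
      simp [Matrix.smul_single]
    simpa only [h2] using h1

/-- The coefficient matrix of the normal variational equations before the gauge transformation. -/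
def Params.normalCoeff (P : Params) (α p : ℂ) : Matrix (Fin 3) (Fin 3) ℂ :=
  (2 / (I * (p ^ 2 - α ^ 2))) • P.dynMatrix α p

/-- The gauge transformation leading to the Fuchsian form. -/
def gauge (α p : ℂ) : Matrix (Fin 3) (Fin 3) ℂ := Matrix.diagonal ![p, p, p ^ 2 - α ^ 2]

/-- The inverse of the gauge transformation. -/
def gaugeInv (α p : ℂ) : Matrix (Fin 3) (Fin 3) ℂ :=
  Matrix.diagonal ![p⁻¹, p⁻¹, (p ^ 2 - α ^ 2)⁻¹]

theorem gaugeInv_mul {α p : ℂ} (hp0 : p ≠ 0) (hp : p ^ 2 ≠ α ^ 2) :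
    gaugeInv α p * gauge α p = 1 := by
  have h1 : p ^ 2 - α ^ 2 ≠ 0 := sub_ne_zero.2 hp
  rw [gauge, gaugeInv, Matrix.diagonal_mul_diagonal, ← Matrix.diagonal_one]
  congr 1
  funext i
  fin_cases i <;> simp [hp0, h1]

theorem gauge_mul {α p : ℂ} (hp0 : p ≠ 0) (hp : p ^ 2 ≠ α ^ 2) :
    gauge α p * gaugeInv α p = 1 :=
  mul_eq_one_comm.1 (gaugeInv_mul hp0 hp)

theorem hasDerivAt_diagonal {g : ℂ → Fin 3 → ℂ} {g' : Fin 3 → ℂ} {z : ℂ}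
    (h : ∀ i, HasDerivAt (fun w => g w i) (g' i) z) :
    HasDerivAt (fun w => Matrix.diagonal (g w)) (Matrix.diagonal g') z := by
  refine hasDerivAt_matrix_iff.2 fun i j => ?_
  by_cases hij : i = j
  · subst hij
    simpa using h i
  · simpa [hij] using hasDerivAt_const z (0 : ℂ)

theorem hasDerivAt_gauge (α p : ℂ) :
    HasDerivAt (gauge α) (Matrix.diagonal ![1, 1, 2 * p]) p := by
  refine hasDerivAt_diagonal fun i => ?_
  fin_cases i
  · exact hasDerivAt_id p
  · exact hasDerivAt_id p
  · simpa using ((hasDerivAt_id p).pow 2).sub_const (α ^ 2)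

theorem hasDerivAt_gaugeInv {α p : ℂ} (hp0 : p ≠ 0) (hp : p ^ 2 ≠ α ^ 2) :
    HasDerivAt (gaugeInv α)
      (-(gaugeInv α p * Matrix.diagonal ![1, 1, 2 * p] * gaugeInv α p)) p := by
  have h1 : p ^ 2 - α ^ 2 ≠ 0 := sub_ne_zero.2 hp
  have h2 : HasDerivAt (fun w : ℂ => w ^ 2 - α ^ 2) (2 * p) p := by
    simpa using ((hasDerivAt_id p).pow 2).sub_const (α ^ 2)
  have h3 := hasDerivAt_diagonal (z := p) (g := fun w => ![w⁻¹, w⁻¹, (w ^ 2 - α ^ 2)⁻¹])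
    (g' := ![-(p ^ 2)⁻¹, -(p ^ 2)⁻¹, -(2 * p) / (p ^ 2 - α ^ 2) ^ 2]) fun i => by
      fin_cases i
      · exact hasDerivAt_inv hp0
      · exact hasDerivAt_inv hp0
      · exact h2.fun_inv h1
  refine h3.congr_deriv ?_
  rw [gaugeInv, Matrix.diagonal_mul_diagonal, Matrix.diagonal_mul_diagonal, Matrix.diagonal_neg]
  congr 1
  funext i
  fin_cases i <;> simp <;> field_simp

/-- The point `0` is not excluded: the only denominators are `p² - α²` and the constant `β`. This is
why transport is defined on the plane punctured only at `±α`. -/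
theorem analyticAt_normalCoeff (P : Params) {α p : ℂ} (hp : p ≠ α ∧ p ≠ -α) :
    AnalyticAt ℂ (P.normalCoeff α) p := by
  have ho : IsOpen {p : ℂ | p ≠ α ∧ p ≠ -α} := isOpen_ne.inter isOpen_ne
  refine DifferentiableOn.analyticAt (s := {p : ℂ | p ≠ α ∧ p ≠ -α}) ?_ (ho.mem_nhds hp)
  intro z hz
  have h1 : z ^ 2 - α ^ 2 ≠ 0 := by
    rw [sq_sub_sq]
    exact mul_ne_zero (fun h => hz.2 (eq_neg_of_add_eq_zero_left h)) (sub_ne_zero.2 hz.1)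
  have h2 : ∀ i j, DifferentiableAt ℂ (fun w => P.normalCoeff α w i j) z := by
    intro i j
    have h3 : I * (z ^ 2 - α ^ 2) ≠ 0 := mul_ne_zero I_ne_zero h1
    fin_cases i <;> fin_cases j <;>
      simp only [Params.normalCoeff, Params.dynMatrix, Matrix.smul_apply, smul_eq_mul,
        Fin.zero_eta, Fin.mk_one, Fin.reduceFinMk, Matrix.of_apply, Matrix.cons_val,
        Matrix.cons_val_zero, Matrix.cons_val_one] <;>
      fun_prop (disch := assumption)
  exact (hasDerivAt_matrix_iff.2 fun i j =>
    (h2 i j).hasDerivAt).differentiableAt.differentiableWithinAt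

/-- The reflection of the direction `γ₃`. -/
def reflection : Matrix (Fin 3) (Fin 3) ℂ := Matrix.diagonal ![1, 1, -1]

theorem reflection_mul_self : reflection * reflection = 1 := by
  rw [reflection, Matrix.diagonal_mul_diagonal, ← Matrix.diagonal_one]
  congr 1
  funext i
  fin_cases i <;> simp

/-- The scalar `2 / (i (p² - α²))` is even. In `dynMatrix` the upper left block is odd, while the
other entries of the third row and column are even and change sign on exactly one side under
`reflection`; the corner entry is `0`. -/
theorem reflection_normalCoeff (P : Params) (α z : ℂ) :
    reflection * P.normalCoeff α (-z) = -(P.normalCoeff α z * reflection) := by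
  ext i j
  rw [reflection, Matrix.diagonal_mul, Matrix.neg_apply, Matrix.mul_diagonal]
  fin_cases i <;> fin_cases j <;> simp [Params.normalCoeff, Params.dynMatrix]

/-- The product rule turns `gauge_coeff` into the equation `(G S)' = (G T + G') S = N (G S)`, where
`G` is the gauge and `T` the Fuchsian coefficient matrix. The point `0` is excluded because `T` has
a pole there. -/
theorem IsFundamentalNear.isSolutionNear {P : Params} {α q : ℂ} (hq0 : q ≠ 0)
    (hq : q ^ 2 ≠ α ^ 2) {S : ℂ → Matrix (Fin 3) (Fin 3) ℂ}
    (hS : IsFundamentalNear (P.coeff α) S q) :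
    IsSolutionNear (P.normalCoeff α) (fun z => gauge α z * S z) q := by
  have h2 : ∀ᶠ z in 𝓝 q, z ^ 2 ≠ α ^ 2 :=
    ((continuous_pow 2).continuousAt (x := q)).eventually_ne hq
  filter_upwards [hS, eventually_ne_nhds hq0, h2] with z hz hz0 hz2
  refine ((hasDerivAt_gauge α z).mul (hasDerivAt_matrix_iff.2 hz.1)).congr_deriv ?_
  have h3 := P.gauge_coeff hz0 hz2
  change gauge α z * P.coeff α z + _ = P.normalCoeff α z * gauge α z at h3
  rw [← mul_assoc, ← mul_assoc, ← h3, add_mul, add_comm]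

theorem IsSolutionNear.isFundamentalNear {P : Params} {α q : ℂ} (hq0 : q ≠ 0)
    (hq : q ^ 2 ≠ α ^ 2) {Y : ℂ → Matrix (Fin 3) (Fin 3) ℂ}
    (hY : IsSolutionNear (P.normalCoeff α) Y q) (hu : IsUnit (Y q)) :
    IsFundamentalNear (P.coeff α) (fun z => gaugeInv α z * Y z) q := by
  have h2 : ∀ᶠ z in 𝓝 q, z ^ 2 ≠ α ^ 2 :=
    ((continuous_pow 2).continuousAt (x := q)).eventually_ne hq
  have h4 : ∀ᶠ z in 𝓝 q, IsUnit (Y z) :=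
    hY.self_of_nhds.continuousAt.eventually_mem (Units.isOpen.mem_nhds hu)
  filter_upwards [hY, eventually_ne_nhds hq0, h2, h4] with z hz hz0 hz2 hzu
  have e1 := gaugeInv_mul hz0 hz2
  constructor
  · refine hasDerivAt_matrix_iff.1 (((hasDerivAt_gaugeInv hz0 hz2).mul hz).congr_deriv ?_)
    have h3 := P.gauge_coeff hz0 hz2
    change gauge α z * P.coeff α z + _ = P.normalCoeff α z * gauge α z at h3
    -- `N = (G T + G') G⁻¹`; the term `G' G⁻¹` cancels the derivative of `G⁻¹`.
    have h5 : P.normalCoeff α z =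
        (gauge α z * P.coeff α z + Matrix.diagonal ![1, 1, 2 * z]) * gaugeInv α z := by
      rw [h3, mul_assoc, gauge_mul hz0 hz2, mul_one]
    rw [h5]
    set d := Matrix.diagonal ![1, 1, 2 * z]
    calc -(gaugeInv α z * d * gaugeInv α z) * Y z + gaugeInv α z *
          ((gauge α z * P.coeff α z + d) * gaugeInv α z * Y z)
        = (gaugeInv α z * gauge α z) * P.coeff α z * (gaugeInv α z * Y z) := by noncomm_ring
      _ = _ := by rw [e1, one_mul]
  · have h6 : IsUnit (gaugeInv α z) := IsUnit.of_mul_eq_one _ e1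
    exact ((Matrix.isUnit_iff_isUnit_det _).1 (h6.mul hzu)).ne_zero

/-- Local frames for the normal variational equations. -/
def normalFrame (P : Params) (α : ℂ) (q : PuncturedPlane α) : LocalFrame (P.normalCoeff α) q :=
  (nonempty_localFrame (analyticAt_normalCoeff P q.2)).some

theorem sq_ne_of_punctured {α : ℂ} (q : PuncturedPlane α) : (q : ℂ) ^ 2 ≠ α ^ 2 := fun h =>
  (sq_eq_sq_iff_eq_or_eq_neg.1 h).elim q.2.1 q.2.2

theorem IsFundamentalNear.isUnit_gauge_mul {P : Params} {α : ℂ} {q : PuncturedPlane α}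
    (hq0 : (q : ℂ) ≠ 0) {S : ℂ → Matrix (Fin 3) (Fin 3) ℂ}
    (hS : IsFundamentalNear (P.coeff α) S q) : IsUnit (gauge α q * S q) :=
  (IsUnit.of_mul_eq_one _ (gauge_mul hq0 (sq_ne_of_punctured q))).mul
    ((Matrix.isUnit_iff_isUnit_det _).2 hS.self_of_nhds.2.isUnit)

/-- The monodromy matrix along a loop is the conjugate of the transport by the initial value. -/
theorem isMonodromy_iff (P : Params) {α : ℂ} {e : PuncturedPlane α} (Γ : Path e e)
    (hΓ : ∀ t, (Γ t : ℂ) ≠ 0) {S : ℂ → Matrix (Fin 3) (Fin 3) ℂ}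
    (hS : IsFundamentalNear (P.coeff α) S e) (M : Matrix (Fin 3) (Fin 3) ℂ) :
    IsMonodromy (P.coeff α) (fun t => (Γ t : ℂ)) S M ↔
      gauge α e * S e * M = transport (normalFrame P α) Γ * (gauge α e * S e) := by
  have he0 : (e : ℂ) ≠ 0 := by simpa using hΓ 0
  have hG := hS.isSolutionNear he0 (sq_ne_of_punctured e)
  have hΓc : ∀ t, Filter.Tendsto (fun t' => (Γ t' : ℂ)) (𝓝 t) (𝓝 (Γ t : ℂ)) := fun t =>
    (continuous_subtype_val.comp Γ.continuous).continuousAt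
  -- The gauge degenerates at `0`; recovering germs of (NVE1) from those of the gauged equation uses
  -- that the loop avoids this point.
  have hinv : ∀ t, ∀ᶠ z in 𝓝 (Γ t : ℂ), gaugeInv α z * gauge α z = 1 := fun t => by
    filter_upwards [eventually_ne_nhds (hΓ t), ((continuous_pow 2).continuousAt
      (x := (Γ t : ℂ))).eventually_ne (sq_ne_of_punctured (Γ t))] with z h1 h2
    exact gaugeInv_mul h1 h2
  constructor
  · rintro ⟨R, ⟨hR1, hR2⟩, hR0, hRM⟩
    have hV : IsFlat (P.normalCoeff α) (fun t => (Γ t : ℂ))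
        fun t => gauge α (Γ t) * R t (Γ t) := fun t =>
      ⟨_, (hR1 t).isSolutionNear (hΓ t) (sq_ne_of_punctured (Γ t)),
        (hR2 t).mono fun t' h' => congrArg (gauge α (Γ t') * ·) h'.self_of_nhds⟩
    have h1 := hV.eq_transport (normalFrame P α)
    have e0 := hR0.self_of_nhds
    have e1 := hRM.self_of_nhds
    simp only [Γ.source, Γ.target] at h1 e0 e1
    rw [mul_assoc, ← e1, h1, e0]
  · intro h
    obtain ⟨V, hV, hV0⟩ := exists_isFlat (normalFrame P α) Γ (gauge α e * S e)
    have hV1 : V 1 = gauge α e * S e * M := by rw [hV.eq_transport (normalFrame P α), hV0, h]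
    have hu := hV.isUnit (normalFrame P α) (by rw [hV0]; exact hS.isUnit_gauge_mul he0)
    choose Y hY hVY using hV
    have hVt : ∀ t, V t = Y t (Γ t) := fun t => (hVY t).self_of_nhds
    -- A solution germ is determined by its value at one point, so equality of values of the gauged
    -- solutions at `Γ t` already identifies the germs of (NVE1).
    have germ : ∀ t {Z : ℂ → Matrix (Fin 3) (Fin 3) ℂ},
        IsSolutionNear (P.normalCoeff α) (fun z => gauge α z * Z z) (Γ t) →
        V t = gauge α (Γ t) * Z (Γ t) → (fun z => gaugeInv α z * Y t z) =ᶠ[𝓝 (Γ t : ℂ)] Z := by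
      intro t Z hZ hVZ
      filter_upwards [(hY t).eventuallyEq (normalFrame P α (Γ t)) hZ (by rw [← hVt, hVZ]),
        hinv t] with z h1 h2
      rw [h1, ← mul_assoc, h2, one_mul]
    refine ⟨fun t z => gaugeInv α z * Y t z, ⟨fun t => ?_, fun t => ?_⟩, ?_, ?_⟩
    · exact (hY t).isFundamentalNear (hΓ t) (sq_ne_of_punctured (Γ t)) (hVt t ▸ hu t)
    · filter_upwards [hVY t, (hΓc t).eventually (hY t).eventually_nhds] with t' h1 h2
      filter_upwards [(hY t').eventuallyEq (normalFrame P α (Γ t')) h2 (by rw [← hVt, h1])]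
        with z h3
      rw [h3]
    · refine germ 0 ?_ ?_
      · rwa [Γ.source]
      · rw [Γ.source, hV0]
    · refine germ 1 ?_ ?_
      · have := hG.mul_const M
        simpa only [mul_assoc, Γ.target] using this
      · rw [Γ.target, hV1, mul_assoc]

/-- The two monodromy matrices exist, are unique, and are interchanged by the conjugation with a
suitable matrix. -/
theorem monodromy_permutationally_conjugate (P : Params) {α : ℂ} (hα : α ≠ 0)
    {e : PuncturedPlane α} (Γ₁ Γ₂ : Path e e)
    (hΓ₁ : ∀ t, (Γ₁ t : ℂ) ≠ 0) (hΓ₂ : ∀ t, (Γ₂ t : ℂ) ≠ 0)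
    (hΓ : IsStandardPair hα Γ₁ Γ₂)
    {S : ℂ → Matrix (Fin 3) (Fin 3) ℂ}
    (hS : IsFundamentalNear (P.coeff α) S e) :
    ∃ Mplus Mminus : GL (Fin 3) ℂ,
      (∀ M : Matrix (Fin 3) (Fin 3) ℂ,
        IsMonodromy (P.coeff α) (fun t => (Γ₁ t : ℂ)) S M ↔ M = Mplus) ∧
      (∀ M : Matrix (Fin 3) (Fin 3) ℂ,
        IsMonodromy (P.coeff α) (fun t => (Γ₂ t : ℂ)) S M ↔ M = Mminus) ∧
      ∃ C : GL (Fin 3) ℂ, C * Mplus * C⁻¹ = Mminus ∧ C * Mminus * C⁻¹ = Mplus := by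
  have he0 : (e : ℂ) ≠ 0 := by simpa using hΓ₁ 0
  obtain ⟨η, h1, h2⟩ := hΓ
  let f := normalFrame P α
  let X : GL (Fin 3) ℂ := (hS.isUnit_gauge_mul he0).unit
  let W : ∀ {a b : PuncturedPlane α}, Path a b → GL (Fin 3) ℂ :=
    fun γ => transportUnit f γ
  let D : GL (Fin 3) ℂ := ⟨reflection, reflection,
    reflection_mul_self, reflection_mul_self⟩
  have mono : ∀ (Γ : Path e e), (∀ t, (Γ t : ℂ) ≠ 0) → ∀ M : Matrix (Fin 3) (Fin 3) ℂ,
      IsMonodromy (P.coeff α) (fun t => (Γ t : ℂ)) S M ↔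
        M = ↑(X⁻¹ * W Γ * X) := by
    intro Γ hΓ M
    -- With `X` the initial value of the gauged fundamental matrix, the criterion `X M = W Γ X` has
    -- the unique solution `M = X⁻¹ W Γ X`, which gives both existence and uniqueness.
    rw [isMonodromy_iff P Γ hΓ hS, mul_assoc X⁻¹, Units.val_mul, Units.eq_inv_mul_iff_mul_eq]
    rfl
  have conj : ∀ {Γ : Path e e} {ℓ : Path (basePoint hα) (basePoint hα)},
      Γ.Homotopic ((η.trans ℓ).trans η.symm) → W Γ = (W η)⁻¹ * W ℓ * W η := by
    intro Γ ℓ hΓ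
    apply Units.ext
    change transport f Γ = transport f η.symm * transport f ℓ *
      transport f η
    rw [transport_eq_of_homotopic f hΓ, transport_trans,
      transport_trans, mul_assoc]
  -- The variable `l` with `l = -k` stands for the opposite index, so that for `k = -2` the second
  -- circle is literally the one with index `2` and not `-(-2)`.
  have twine : ∀ {k l : ℂ} (hk : k = 2 ∨ k = -2) (hl : l = 2 ∨ l = -2), l = -k →
      D * W (diameterPath hα) * W (circleLoop hα hk) =
        W (circleLoop hα hl) * (D * W (diameterPath hα)) := by
    rintro k l hk hl rfl
    exact Units.ext (intertwine_circleLoop f (reflection_normalCoeff P α)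
      reflection_mul_self hα hk)
  have t1 := twine (Or.inl rfl) (Or.inr rfl) rfl
  have t2 := twine (Or.inr rfl) (Or.inl rfl) (neg_neg _).symm
  -- The conjugating matrix is `D W(δ)`, with `δ` the diameter path, carried from `iα` to `e` along
  -- `η` and expressed in the basis given by `X`. It does not depend on the sign of `k`, so `t1` and
  -- `t2` give the two exchanges.
  refine ⟨X⁻¹ * W Γ₁ * X, X⁻¹ * W Γ₂ * X, mono Γ₁ hΓ₁, mono Γ₂ hΓ₂,
    X⁻¹ * (W η)⁻¹ * (D * W (diameterPath hα)) * W η * X, ?_, ?_⟩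
  · rw [conj h1, conj h2, mul_inv_eq_iff_eq_mul]
    have := congrArg (fun g => X⁻¹ * (W η)⁻¹ * g * W η * X) t1
    simp only [mul_assoc, mul_inv_cancel_left] at this ⊢
    exact this
  · rw [conj h1, conj h2, mul_inv_eq_iff_eq_mul]
    have := congrArg (fun g => X⁻¹ * (W η)⁻¹ * g * W η * X) t2
    simp only [mul_assoc, mul_inv_cancel_left] at this ⊢
    exact this

end Matrices

end Rattleback
end

theorem mainTheorem5 (P : Rattleback.Params) (h α : ℂ) (hα : α ≠ 0)
    (hαh : α ^ 2 = 2 * h / (P.m * (P.b₁ ^ 2 + P.b₂ ^ 2) + P.J₃₃))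
    (e : Rattleback.PuncturedPlane α) (Γ₁ Γ₂ : Path e e)
    (hΓ₁ : ∀ t, (Γ₁ t : ℂ) ≠ 0) (hΓ₂ : ∀ t, (Γ₂ t : ℂ) ≠ 0)
    (hΓ : Rattleback.IsStandardPair hα Γ₁ Γ₂)
    (S : ℂ → Matrix (Fin 3) (Fin 3) ℂ)
    (hS : Rattleback.IsFundamentalNear (P.coeff α) S e) :
    ∃ Mplus Mminus : GL (Fin 3) ℂ,
      (∀ M : Matrix (Fin 3) (Fin 3) ℂ,
        Rattleback.IsMonodromy (P.coeff α) (fun t => (Γ₁ t : ℂ)) S M ↔ M = Mplus) ∧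
      (∀ M : Matrix (Fin 3) (Fin 3) ℂ,
        Rattleback.IsMonodromy (P.coeff α) (fun t => (Γ₂ t : ℂ)) S M ↔ M = Mminus) ∧
      ∃ C : GL (Fin 3) ℂ, C * Mplus * C⁻¹ = Mminus ∧ C * Mminus * C⁻¹ = Mplus := by
  exact Rattleback.monodromy_permutationally_conjugate P hα Γ₁ Γ₂ hΓ₁ hΓ₂ hΓ hS
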